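/- **Definitions.** Graphs are finite and simple. Two bit pairs are *pair related*, $x_1x_0\sim y_1y_0$, if $(x_1x_0,y_1y_0)\in\{(00,00),(10,10),(01,11),(11,01)\}$. The *crossed cube* $CQ_n$ ($n\ge1$) has as vertices the binary strings $u_{n-1}\cdots u_0$. $CQ_1=K_2$; for $n\ge2$, $CQ_n$ consists of the copies $CQ_{n-1}^0$ and $CQ_{n-1}^1$ of $CQ_{n-1}$, whose strings are prefixed with $0$ and $1$ respectively, together with the edges joining $0u_{n-2}\cdots u_0$ to $1v_{n-2}\cdots v_0$ exactly when $u_{n-2}=v_{n-2}$ if $n$ is even, and $u_{2i+1}u_{2i}\sim v_{2i+1}v_{2i}$ for all $0\le i<\lfloor\frac{n-1}{2}\rfloor$. The *BCDC network* $B_n$ ($n\ge2$) has unordered pairs $[x,y]$ of binary strings of length $n$ as vertices. $B_2$ is the $4$-cycle $[00,01],[00,10],[10,11],[01,11]$ (in this cyclic order). For $n\ge3$, $B_n$ consists of two copies $B_{n-1}^0$ and $B_{n-1}^1$ of $B_{n-1}$, in which both strings of every vertex are prefixed with $0$ and $1$ respectively, and of the independent set $S_n$ of all $[c,d]$ with $c\in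 V(CQ_{n-1}^0)$, $d\in V(CQ_{n-1}^1)$ and $cd\in E(CQ_n)$; a vertex $[a,b]$ of $B_{n-1}^0$ is adjacent to $[c,d]\in S_n$ iff $a=c$ or $b=c$, a vertex $[e,f]$ of $B_{n-1}^1$ is adjacent to $[c,d]\in S_n$ iff $e=d$ or $f=d$, and there are no edges between $B_{n-1}^0$ and $B_{n-1}^1$. For graphs $G$ and $H$, an *$H$-structure cut* of $G$ is a set $\mathcal F$ of (not necessarily disjoint or induced) subgraphs of $G$, each isomorphic to $H$, such that deleting from $G$ all vertices of the members of $\mathcal F$ leaves a disconnected graph or a graph with exactly one vertex. The *$H$-structure connectivity* $\kappa(G;H)$ is the least number of members of an $H$-structure cut of $G$. $C_k$ denotes the cycle on $k$ vertices. **Theorem.** Let $n\ge5$ and $6\le k\le 2n$, and let $r$ be the remainder of $n-1$ divided by $k$. Then $B_n$ has a $C_k$-structure cut, and $$\kappa(B_n;C_k)=\begin{cases}2\left\lceil\frac{n-1}{k}\right\rceil-1,&\text{if } \bigl(6\le k\le n-1\text{ and }1\le r\le\lfloor\frac k2\rfloor-1\bigr)\text{ or }k=2n,\\[2pt]3,&\text{if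 }k=n,\\[2pt]2\left\lceil\frac{n-1}{k}\right\rceil,&\text{otherwise.}\end{cases}$$ -/

import Mathlib

/-- Two bit pairs `x = x₁x₀` and `y = y₁y₀` are pair related when
`(x, y) ∈ {(00, 00), (10, 10), (01, 11), (11, 01)}`. -/
def PairRelated (x y : Bool × Bool) : Prop :=
  (x, y) ∈ ({((false, false), (false, false)), ((true, false), (true, false)),
    ((false, true), (true, true)), ((true, true), (false, true))} :
      Set ((Bool × Bool) × (Bool × Bool)))

/-- Putting the bit `b` in front of the binary string `u = u_{n-1} … u_0`, as the new leading
bit. The bit `u_i` of `u : BitVec n` is `u.getLsbD i`. -/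
def prependBit (b : Bool) (n : ℕ) : BitVec n ↪ BitVec (n + 1) where
  toFun u := BitVec.cons b u
  inj' u v h := by
    apply BitVec.eq_of_getLsbD_eq
    intro i hi
    have := congrArg (fun x : BitVec (n + 1) => x.getLsbD i) h
    simpa [BitVec.getLsbD_cons, hi.ne] using this

/-- The condition for `0u` and `1v` to be joined in the crossed cube of dimension `m + 2`, where
`u = u_m … u_0` and `v = v_m … v_0`: `u_m = v_m` if the dimension is even, and
`u_{2i+1} u_{2i} ∼ v_{2i+1} v_{2i}` for `0 ≤ i < ⌊(m + 1) / 2⌋`. -/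
def CrossCondition (m : ℕ) (u v : BitVec (m + 1)) : Prop :=
  (Even (m + 2) → u.getLsbD m = v.getLsbD m) ∧
    ∀ i < (m + 1) / 2, PairRelated (u.getLsbD (2 * i + 1), u.getLsbD (2 * i))
      (v.getLsbD (2 * i + 1), v.getLsbD (2 * i))

/-- The crossed cube `CQ_n` on the binary strings of length `n`: `CQ_1 = K_2`, and for `n ≥ 2` it
consists of the copies `CQ^0_{n-1}` and `CQ^1_{n-1}` of `CQ_{n-1}` and of the edges between them
given by `CrossCondition`. (The value at `n = 0` is not used.) -/
def crossedCube : (n : ℕ) → SimpleGraph (BitVec n)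
  | 0 => ⊥
  | 1 => ⊤
  | m + 2 =>
      (crossedCube (m + 1)).map (prependBit false (m + 1)) ⊔
      (crossedCube (m + 1)).map (prependBit true (m + 1)) ⊔
      SimpleGraph.fromRel (fun x y => ∃ u v : BitVec (m + 1),
        x = prependBit false (m + 1) u ∧ y = prependBit true (m + 1) v ∧ CrossCondition m u v)

/-- The vertices `[a, b]` (unordered pairs) of the independent set `S_n`, for `n = m + 1`: the
edges `ab` of `CQ_n` with `a` in `CQ^0_{n-1}` and `b` in `CQ^1_{n-1}`. -/
def bcdcCross (m : ℕ) : Set (Sym2 (BitVec (m + 1))) :=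
  {e | ∃ a b : BitVec m, e = s(prependBit false m a, prependBit true m b) ∧
    (crossedCube (m + 1)).Adj (prependBit false m a) (prependBit true m b)}

/-- The vertex set of `B_n`, for `n ≥ 2`: `V(B_2) = {[00,01], [00,10], [01,11], [10,11]}`, and
`V(B_n)` consists of the vertices of `B_{n-1}` prefixed with `0`, of those prefixed with `1`, and
of `S_n`. (The values at `n = 0, 1` are not used.) -/
def bcdcVerts : (n : ℕ) → Set (Sym2 (BitVec n))
  | 0 => ∅
  | 1 => ∅
  | 2 => {s(0b00#2, 0b01#2), s(0b00#2, 0b10#2), s(0b01#2, 0b11#2), s(0b10#2, 0b11#2)}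
  | m + 3 =>
      Sym2.map (prependBit false (m + 2)) '' bcdcVerts (m + 2) ∪
      Sym2.map (prependBit true (m + 2)) '' bcdcVerts (m + 2) ∪
      bcdcCross (m + 2)

/-- The edges of `B_n`, for `n ≥ 2`, as a graph on all unordered pairs of binary strings of
length `n`. `B_2` is the 4-cycle `[00,01], [00,10], [10,11], [01,11]`. For `n ≥ 3` there are the
edges of the two prefixed copies of `B_{n-1}`; `[a, b]` in `B^0_{n-1}` is joined to `[c, d]` in
`S_n` iff `a = c` or `b = c`; and `[e, f]` in `B^1_{n-1}` is joined to `[c, d]` in `S_n` iff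
`e = d` or `f = d`. Here `c` is the end of `[c, d]` in `CQ^0_{n-1}`, `d` the one in
`CQ^1_{n-1}`. -/
def bcdcAmbient : (n : ℕ) → SimpleGraph (Sym2 (BitVec n))
  | 0 => ⊥
  | 1 => ⊥
  | 2 => SimpleGraph.fromEdgeSet
      {s(s(0b00#2, 0b01#2), s(0b00#2, 0b10#2)), s(s(0b00#2, 0b10#2), s(0b10#2, 0b11#2)),
        s(s(0b10#2, 0b11#2), s(0b01#2, 0b11#2)), s(s(0b01#2, 0b11#2), s(0b00#2, 0b01#2))}
  | m + 3 =>
      (bcdcAmbient (m + 2)).map (prependBit false (m + 2)).sym2Map ⊔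
      (bcdcAmbient (m + 2)).map (prependBit true (m + 2)).sym2Map ⊔
      SimpleGraph.fromRel (fun p q => ∃ a b c d : BitVec (m + 2),
        p = s(prependBit false (m + 2) a, prependBit false (m + 2) b) ∧
        s(a, b) ∈ bcdcVerts (m + 2) ∧
        q = s(prependBit false (m + 2) c, prependBit true (m + 2) d) ∧
        q ∈ bcdcCross (m + 2) ∧ (a = c ∨ b = c)) ⊔
      SimpleGraph.fromRel (fun p q => ∃ e f c d : BitVec (m + 2),
        p = s(prependBit true (m + 2) e, prependBit true (m + 2) f) ∧
        s(e, f) ∈ bcdcVerts (m + 2) ∧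
        q = s(prependBit false (m + 2) c, prependBit true (m + 2) d) ∧
        q ∈ bcdcCross (m + 2) ∧ (e = d ∨ f = d))

/-- The `n`-dimensional BCDC network `B_n` (for `n ≥ 2`). -/
def bcdc (n : ℕ) : SimpleGraph (bcdcVerts n) :=
  (bcdcAmbient n).induce (bcdcVerts n)

/-- `V(𝓕)`: the union of the vertex sets of the members of a set `𝓕` of subgraphs. -/
def familyVerts {V : Type*} {G : SimpleGraph V} (F : Set G.Subgraph) : Set V :=
  ⋃ S ∈ F, S.verts

/-- `𝓕` is a subgraph cut of `G`: `G - V(𝓕)` is disconnected, or it is the trivial graph (it has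
exactly one vertex). -/
def IsSubgraphCut {V : Type*} (G : SimpleGraph V) (F : Set G.Subgraph) : Prop :=
  ¬ (G.induce (familyVerts F)ᶜ).Preconnected ∨ ∃ v : V, (familyVerts F)ᶜ = {v}

/-- `𝓕` is an `H`-structure cut of `G`: a subgraph cut all of whose members are isomorphic
to `H`. -/
def IsStructureCut {V W : Type*} (G : SimpleGraph V) (H : SimpleGraph W) (F : Set G.Subgraph) :
    Prop :=
  IsSubgraphCut G F ∧ ∀ S ∈ F, Nonempty (S.coe ≃g H)

/-- The `H`-structure connectivity `κ(G; H)`: the least size of an `H`-structure cut of `G`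
(`⊤` if there is none). -/
noncomputable def structureConnectivity {V W : Type*} (G : SimpleGraph V) (H : SimpleGraph W) :
    ℕ∞ :=
  ⨅ F ∈ {F : Set G.Subgraph | IsStructureCut G H F}, F.encard

/-! $B_n$ is the line graph of $CQ_n$ (`structureConnectivity_bcdc`). The crossed cube enters only
through being $n$-regular and triangle-free, through an edge-isoperimetric inequality, and through
one local configuration, the ladder.

Lower bound. After a cut, one component of the line graph covers a vertex set $X$ of $CQ_n$, and
every edge leaving $X$ has been deleted. If $X$ and its complement both have at least three
elements, there are at least $3n-4\ge 2n+1$ such edges, so $t$ cycles need $kt\ge 2n+1$. Otherwise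
some edge $uv$ is isolated, and the cycles cover the $n-1$ other edges at $u$ and the $n-1$ other
edges at $v$. These two cliques have no edges between them, as there are no triangles; so a cycle
meeting both spends at least two of its $k$ vertices outside (`ncard_edgeStar_add_two_le`). Hence
either $2n\le kt$, or each cycle serves only one end and $t\ge 2q$ with $q=\lceil (n-1)/k\rceil$
(`IsStructureCut.card_bounds`). The first alternative permits $t=2q-1$ exactly in the first case of
the formula. For $k=n$, two cycles do not suffice: a cycle cannot have exactly one vertex outside a
star (`ncard_edgeStar_add_one_ne`), so each cycle covers at most $n-2$ of the $2(n-1)$ edges.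

Upper bound. An edge $uv$ is isolated by cycles of three kinds: $k$ edges within one star; edges at
$u$ closed up through the star of the opposite corner $w$ of a 4-cycle (`IsClaw.hasCycleOn`); and a
cycle through both stars with only two vertices outside (`IsLadder.hasCycleOn`), which attains the
bound above. -/

/-! ### The crossed cube: recursion, regularity, no triangles -/

/-- The involution of the binary strings of length `m` which sends `u` to the only `v` such that
`0u` and `1v` are joined in the crossed cube: the bits at odd positions are changed by the bit to
their right. -/
def crossMap {m : ℕ} (u : BitVec m) : BitVec m :=
  BitVec.ofFnLE fun i => (u.getLsbD i ^^ (decide (i.val % 2 = 1) && u.getLsbD (i.val - 1)))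

theorem getLsbD_crossMap {m : ℕ} (u : BitVec m) (i : ℕ) (hi : i < m) :
    (crossMap u).getLsbD i = (u.getLsbD i ^^ (decide (i % 2 = 1) && u.getLsbD (i - 1))) := by
  simp [crossMap, hi]

theorem crossMap_crossMap {m : ℕ} (u : BitVec m) : crossMap (crossMap u) = u := by
  apply BitVec.eq_of_getLsbD_eq
  intro i hi
  rw [getLsbD_crossMap _ _ hi, getLsbD_crossMap _ _ hi, getLsbD_crossMap _ _ (by omega)]
  by_cases h : i % 2 = 1
  · have : ¬ (i - 1) % 2 = 1 := by omega
    simp [h, this]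
  · simp [h]

theorem crossMap_injective {m : ℕ} : Function.Injective (crossMap (m := m)) :=
  Function.LeftInverse.injective crossMap_crossMap

theorem pairRelated_iff (x₁ x₀ y₁ y₀ : Bool) :
    PairRelated (x₁, x₀) (y₁, y₀) ↔ y₀ = x₀ ∧ y₁ = (x₁ ^^ x₀) := by
  simp only [PairRelated, Set.mem_insert_iff, Set.mem_singleton_iff, Prod.mk.injEq]
  revert x₁ x₀ y₁ y₀
  decide

theorem crossCondition_iff {m : ℕ} (u v : BitVec (m + 1)) :
    CrossCondition m u v ↔ v = crossMap u := by
  simp only [CrossCondition, pairRelated_iff]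
  constructor
  · rintro ⟨h1, h2⟩
    apply BitVec.eq_of_getLsbD_eq
    intro i hi
    rw [getLsbD_crossMap _ _ hi]
    rcases Nat.even_or_odd' i with ⟨j, rfl | rfl⟩
    · have h0 : ¬ (2 * j) % 2 = 1 := by omega
      by_cases hj : j < (m + 1) / 2
      · simp [(h2 j hj).1]
      -- The unpaired leading bit, which the parity clause of `CrossCondition` fixes.
      · obtain rfl : m = 2 * j := by omega
        rw [← h1 (by simp [parity_simps])]
        simp
    · have h0 : (2 * j + 1) % 2 = 1 := by omega
      simp [(h2 j (by omega)).2]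
  · rintro rfl
    constructor
    · intro h
      have : ¬ m % 2 = 1 := by
        have := Nat.even_iff.1 h
        omega
      rw [getLsbD_crossMap _ _ (by omega)]
      simp [this]
    · intro i hi
      rw [getLsbD_crossMap _ _ (by omega), getLsbD_crossMap _ _ (by omega)]
      have h0 : (2 * i + 1) % 2 = 1 := by omega
      simp

theorem cons_inj {m : ℕ} {b c : Bool} {u v : BitVec m} :
    BitVec.cons b u = BitVec.cons c v ↔ b = c ∧ u = v := by
  constructor
  · intro h
    have hb : b = c := by
      have := congrArg (fun x : BitVec (m + 1) => x.getLsbD m) h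
      simpa only [BitVec.getLsbD_cons, if_true] using this
    subst hb
    exact ⟨rfl, (prependBit b m).injective h⟩
  · rintro ⟨rfl, rfl⟩
    rfl

theorem exists_eq_cons {m : ℕ} (x : BitVec (m + 1)) :
    ∃ (b : Bool) (u : BitVec m), x = BitVec.cons b u :=
  ⟨x.msb, x.setWidth m, (BitVec.cons_msb_setWidth x).symm⟩

theorem prependBit_apply (b : Bool) (m : ℕ) (u : BitVec m) :
    prependBit b m u = BitVec.cons b u := rfl

/-- With the edgeless graph in dimension $0$ the recursion also produces $CQ_1=K_2$, so inductions
can start at $0$. -/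
theorem crossedCube_adj_cons {m : ℕ} (b c : Bool) (u v : BitVec m) :
    (crossedCube (m + 1)).Adj (BitVec.cons b u) (BitVec.cons c v) ↔
      b = c ∧ (crossedCube m).Adj u v ∨ b ≠ c ∧ v = crossMap u := by
  cases m with
  | zero =>
    have h1 : u = v := Subsingleton.elim _ _
    simp only [crossedCube, cons_inj, h1, SimpleGraph.top_adj, SimpleGraph.bot_adj, ne_eq, and_true,
      and_false, false_or, iff_self_and]
    exact fun _ => Subsingleton.elim _ _
  | succ m =>
    have hs : ∀ u v : BitVec (m + 1), u = crossMap v ↔ v = crossMap u := fun u v =>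
      ⟨fun h => by rw [h, crossMap_crossMap], fun h => by rw [h, crossMap_crossMap]⟩
    simp only [crossedCube, SimpleGraph.sup_adj, SimpleGraph.map_adj, SimpleGraph.fromRel_adj,
      prependBit_apply, cons_inj, crossCondition_iff, ne_eq]
    cases b <;> cases c <;> simp [hs u v]

instance (n : ℕ) : Finite (BitVec n) := Finite.of_equiv _ BitVec.equivFin.toEquiv.symm

theorem card_bitVec (n : ℕ) : Nat.card (BitVec n) = 2 ^ n := by
  rw [Nat.card_congr BitVec.equivFin.toEquiv, Nat.card_fin]

theorem crossedCube_triangleFree (n : ℕ) (x y z : BitVec n) (hxy : (crossedCube n).Adj x y)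
    (hyz : (crossedCube n).Adj y z) (hxz : (crossedCube n).Adj x z) : False := by
  induction n with
  | zero => exact hxy
  | succ n ih =>
    obtain ⟨b, u, rfl⟩ := exists_eq_cons x
    obtain ⟨c, v, rfl⟩ := exists_eq_cons y
    obtain ⟨d, w, rfl⟩ := exists_eq_cons z
    rw [crossedCube_adj_cons] at hxy hyz hxz
    rcases hxy with ⟨rfl, h1⟩ | ⟨h, h1⟩ <;> rcases hyz with ⟨rfl, h2⟩ | ⟨h', h2⟩ <;>
      rcases hxz with ⟨h3, h4⟩ | ⟨h3, h4⟩
    · exact ih u v w h1 h2 h4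
    · exact h3 rfl
    · exact h' h3
    · exact h1.ne (crossMap_injective (h4.symm.trans h2))
    · exact h h3
    · exact h2.ne (h1.trans h4.symm)
    · subst h1 h2
      rw [crossMap_crossMap] at h4
      exact h4.ne rfl
    · revert h h' h3
      cases b <;> cases c <;> cases d <;> simp

theorem ncard_neighborSet_crossedCube (n : ℕ) (x : BitVec n) :
    ((crossedCube n).neighborSet x).ncard = n := by
  induction n with
  | zero => simp [crossedCube, SimpleGraph.neighborSet]
  | succ n ih =>
    obtain ⟨b, u, rfl⟩ := exists_eq_cons x
    have : (crossedCube (n + 1)).neighborSet (BitVec.cons b u) =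
        insert (BitVec.cons (!b) (crossMap u))
          (prependBit b n '' (crossedCube n).neighborSet u) := by
      ext y
      obtain ⟨c, v, rfl⟩ := exists_eq_cons y
      simp only [SimpleGraph.mem_neighborSet, crossedCube_adj_cons, Set.mem_insert_iff, cons_inj,
        Set.mem_image, prependBit_apply]
      cases b <;> cases c <;> simp
    rw [this, Set.ncard_insert_of_notMem _ (Set.toFinite _),
      Set.ncard_image_of_injective _ (prependBit b n).injective, ih]
    simp [prependBit_apply, cons_inj]

/-! ### Edge-isoperimetry in the crossed cube -/

/-- The pairs `(x, y)` of adjacent vertices with `x` in `X` and `y` outside of `X`. -/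
def boundaryPairs {V : Type*} (G : SimpleGraph V) (X : Set V) : Set (V × V) :=
  {p | p.1 ∈ X ∧ p.2 ∉ X ∧ G.Adj p.1 p.2}

/-- The strings which after prefixing the bit `b` lie in `X`. -/
def bitSlice {n : ℕ} (b : Bool) (X : Set (BitVec (n + 1))) : Set (BitVec n) :=
  {u | BitVec.cons b u ∈ X}

theorem mem_bitSlice {n : ℕ} {b : Bool} {X : Set (BitVec (n + 1))} {u : BitVec n} :
    u ∈ bitSlice b X ↔ BitVec.cons b u ∈ X := Iff.rfl

theorem ncard_bitSlice_add {n : ℕ} (X : Set (BitVec (n + 1))) :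
    (bitSlice false X).ncard + (bitSlice true X).ncard = X.ncard := by
  have : X = prependBit false n '' bitSlice false X ∪ prependBit true n '' bitSlice true X := by
    ext x
    obtain ⟨b, u, rfl⟩ := exists_eq_cons x
    simp only [Set.mem_union, Set.mem_image, mem_bitSlice, prependBit_apply, cons_inj]
    cases b <;> simp
  conv_rhs => rw [this]
  rw [Set.ncard_union_eq _ (Set.toFinite _) (Set.toFinite _),
    Set.ncard_image_of_injective _ (prependBit false n).injective,
    Set.ncard_image_of_injective _ (prependBit true n).injective]
  rw [Set.disjoint_left]
  rintro _ ⟨u, -, rfl⟩ ⟨v, -, h⟩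
  simp [prependBit_apply, cons_inj] at h

theorem ncard_bitSlice_le {n : ℕ} (b : Bool) (X : Set (BitVec (n + 1))) :
    (bitSlice b X).ncard ≤ 2 ^ n := by
  rw [← card_bitVec]
  exact Set.ncard_le_card _

/-- The cross edges form a perfect matching of the two halves, so a surplus of $X$ in one half
forces that many cross edges out of $X$. The subtraction is truncated; swapping the halves gives the
other sign. -/
theorem boundaryPairs_slices_le {n : ℕ} (b : Bool) (X : Set (BitVec (n + 1))) :
    (boundaryPairs (crossedCube n) (bitSlice b X)).ncard +
      (boundaryPairs (crossedCube n) (bitSlice (!b) X)).ncard +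
      ((bitSlice b X).ncard - (bitSlice (!b) X).ncard) ≤
      (boundaryPairs (crossedCube (n + 1)) X).ncard := by
  have hinj : ∀ c, Function.Injective (Prod.map (prependBit c n) (prependBit c n)) := fun c =>
    (prependBit c n).injective.prodMap (prependBit c n).injective
  have hinj' : Function.Injective (fun u : BitVec n =>
      (prependBit b n u, prependBit (!b) n (crossMap u))) := fun u v h =>
    (prependBit b n).injective (congrArg Prod.fst h)
  have hC : (bitSlice b X).ncard - (bitSlice (!b) X).ncard ≤
      (bitSlice b X \ crossMap '' bitSlice (!b) X).ncard := by
    have := Set.le_ncard_sdiff (crossMap '' bitSlice (!b) X) (bitSlice b X)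
    rwa [Set.ncard_image_of_injective _ crossMap_injective] at this
  refine (Nat.add_le_add_left hC _).trans ?_
  rw [← Set.ncard_image_of_injective (boundaryPairs (crossedCube n) (bitSlice b X)) (hinj b),
    ← Set.ncard_image_of_injective (boundaryPairs (crossedCube n) (bitSlice (!b) X)) (hinj !b),
    ← Set.ncard_image_of_injective (bitSlice b X \ _) hinj',
    ← Set.ncard_union_eq _ (Set.toFinite _) (Set.toFinite _),
    ← Set.ncard_union_eq _ (Set.toFinite _) (Set.toFinite _)]
  · refine Set.ncard_le_ncard ?_ (Set.toFinite _)
    rintro _ ((⟨⟨u, v⟩, ⟨h1, h2, h3⟩, rfl⟩ | ⟨⟨u, v⟩, ⟨h1, h2, h3⟩, rfl⟩) | ⟨u, ⟨h1, h2⟩, rfl⟩)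
    · exact ⟨h1, h2, (crossedCube_adj_cons _ _ _ _).2 (Or.inl ⟨rfl, h3⟩)⟩
    · exact ⟨h1, h2, (crossedCube_adj_cons _ _ _ _).2 (Or.inl ⟨rfl, h3⟩)⟩
    · refine ⟨h1, fun h => h2 ⟨_, h, crossMap_crossMap u⟩,
        (crossedCube_adj_cons _ _ _ _).2 (Or.inr ⟨by cases b <;> simp, rfl⟩)⟩
  · rw [Set.disjoint_left]
    rintro _ (⟨⟨u, v⟩, -, rfl⟩ | ⟨⟨u, v⟩, -, rfl⟩) ⟨w, -, h⟩ <;>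
      simp [prependBit_apply, cons_inj, Prod.ext_iff] at h
  · rw [Set.disjoint_left]
    rintro _ ⟨⟨u, v⟩, -, rfl⟩ ⟨w, -, h⟩
    simp [prependBit_apply, cons_inj, Prod.ext_iff] at h

theorem exists_slice_profile {n : ℕ} (X : Set (BitVec (n + 1))) :
    ∃ Y Z : Set (BitVec n), Y.ncard + Z.ncard = X.ncard ∧ Y.ncard ≤ 2 ^ n ∧ Z.ncard ≤ 2 ^ n ∧
      (boundaryPairs (crossedCube n) Y).ncard + (boundaryPairs (crossedCube n) Z).ncard +
        (Y.ncard - Z.ncard) ≤ (boundaryPairs (crossedCube (n + 1)) X).ncard ∧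
      (boundaryPairs (crossedCube n) Y).ncard + (boundaryPairs (crossedCube n) Z).ncard +
        (Z.ncard - Y.ncard) ≤ (boundaryPairs (crossedCube (n + 1)) X).ncard := by
  refine ⟨bitSlice false X, bitSlice true X, ncard_bitSlice_add X, ncard_bitSlice_le _ _,
    ncard_bitSlice_le _ _, boundaryPairs_slices_le false X, ?_⟩
  rw [add_comm (boundaryPairs _ _).ncard]
  exact boundaryPairs_slices_le true X

theorem le_ncard_boundaryPairs_of_one_le {n : ℕ} (X : Set (BitVec n)) (h : 1 ≤ X.ncard)
    (h' : X.ncard + 1 ≤ 2 ^ n) : n ≤ (boundaryPairs (crossedCube n) X).ncard := by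
  induction n with
  | zero => exact Nat.zero_le _
  | succ n ih =>
    obtain ⟨Y, Z, h1, h2, h3, h4, h5⟩ := exists_slice_profile X
    have hY := ih Y
    have hZ := ih Z
    have := Nat.lt_two_pow_self (n := n)
    rw [pow_succ] at h'
    clear ih
    rcases n with _ | n
    · omega
    · generalize 2 ^ (n + 1) = N at *
      omega

theorem le_ncard_boundaryPairs_of_two_le {n : ℕ} (X : Set (BitVec n)) (h : 2 ≤ X.ncard)
    (h' : X.ncard + 2 ≤ 2 ^ n) : 2 * n ≤ (boundaryPairs (crossedCube n) X).ncard + 2 := by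
  induction n with
  | zero => omega
  | succ n ih =>
    obtain ⟨Y, Z, h1, h2, h3, h4, h5⟩ := exists_slice_profile X
    have hY := ih Y
    have hZ := ih Z
    have hY' := le_ncard_boundaryPairs_of_one_le Y
    have hZ' := le_ncard_boundaryPairs_of_one_le Z
    have hN : n = 0 ∨ n = 1 ∨ 2 ≤ n := by omega
    rw [pow_succ] at h'
    rcases hN with rfl | rfl | hN
    · omega
    · omega
    -- Needed when one slice is full and the other empty: only the $2^n$ cross edges count then.
    · have : 2 * n ≤ 2 ^ n := by
        obtain ⟨m, rfl⟩ := Nat.exists_eq_add_of_le' hN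
        have := Nat.lt_two_pow_self (n := m + 1)
        rw [pow_succ]
        omega
      clear ih
      generalize 2 ^ n = N at *
      omega

/-- The bound $3n-4$ fails for $n=3$ at a copy of $CQ_2$, which has four vertices and boundary $4$.
It holds for the sizes $3$ and $5$, and this suffices for the base case $n=4$ of the next lemma. -/
theorem le_ncard_boundaryPairs_crossedCube_three (X : Set (BitVec 3))
    (h : X.ncard = 3 ∨ X.ncard = 5) : 5 ≤ (boundaryPairs (crossedCube 3) X).ncard := by
  obtain ⟨Y, Z, h1, h2, h3, h4, h5⟩ := exists_slice_profile X
  have hY := le_ncard_boundaryPairs_of_two_le Y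
  have hZ := le_ncard_boundaryPairs_of_two_le Z
  have hY' := le_ncard_boundaryPairs_of_one_le Y
  have hZ' := le_ncard_boundaryPairs_of_one_le Z
  norm_num at h2 h3 hY hZ hY' hZ'
  change _ ≤ (boundaryPairs (crossedCube 3) X).ncard at h4 h5
  omega

theorem le_ncard_boundaryPairs_of_three_le {n : ℕ} (hn : 4 ≤ n) (X : Set (BitVec n))
    (h : 3 ≤ X.ncard) (h' : X.ncard + 3 ≤ 2 ^ n) :
    3 * n ≤ (boundaryPairs (crossedCube n) X).ncard + 4 := by
  induction n, hn using Nat.le_induction with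
  | base =>
    obtain ⟨Y, Z, h1, h2, h3, h4, h5⟩ := exists_slice_profile X
    have hY := le_ncard_boundaryPairs_of_two_le Y
    have hZ := le_ncard_boundaryPairs_of_two_le Z
    have hY' := le_ncard_boundaryPairs_of_one_le Y
    have hZ' := le_ncard_boundaryPairs_of_one_le Z
    have hY'' := le_ncard_boundaryPairs_crossedCube_three Y
    have hZ'' := le_ncard_boundaryPairs_crossedCube_three Z
    norm_num at h' h2 h3 hY hZ hY' hZ' hY'' hZ''
    change _ ≤ (boundaryPairs (crossedCube 4) X).ncard at h4 h5
    omega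
  | succ n hn ih =>
    obtain ⟨Y, Z, h1, h2, h3, h4, h5⟩ := exists_slice_profile X
    have hY := ih Y
    have hZ := ih Z
    have hY' := le_ncard_boundaryPairs_of_two_le Y
    have hZ' := le_ncard_boundaryPairs_of_two_le Z
    have hY'' := le_ncard_boundaryPairs_of_one_le Y
    have hZ'' := le_ncard_boundaryPairs_of_one_le Z
    -- A full slice facing an empty one has to give $3(n+1)-4\le 2^n$.
    have : 3 * n ≤ 2 ^ n + 1 := by
      clear * - hn
      induction n, hn using Nat.le_induction with
      | base => norm_num
      | succ n hn ih =>
        rw [pow_succ]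
        omega
    rw [pow_succ] at h'
    clear ih
    generalize 2 ^ n = N at *
    omega

/-! ### The BCDC network as the line graph of the crossed cube -/

theorem bitVec_two_eq_cons (b c : Bool) :
    BitVec.cons b (BitVec.cons c 0#0) = BitVec.ofNat 2 (2 * b.toNat + c.toNat) := by
  cases b <;> cases c <;> rfl

theorem exists_eq_cons_cons (x : BitVec 2) :
    ∃ b c : Bool, x = BitVec.cons b (BitVec.cons c 0#0) := by
  obtain ⟨b, u, rfl⟩ := exists_eq_cons x
  obtain ⟨c, t, rfl⟩ := exists_eq_cons u
  exact ⟨b, c, by rw [Subsingleton.elim t 0#0]⟩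

theorem mem_map_prependBit_image {m : ℕ} {b c d : Bool} {u v : BitVec m}
    {E : Set (Sym2 (BitVec m))} :
    s(BitVec.cons b u, BitVec.cons c v) ∈ Sym2.map (prependBit d m) '' E ↔
      b = d ∧ c = d ∧ s(u, v) ∈ E := by
  constructor
  · rintro ⟨e, he, h⟩
    induction e with
    | _ p q =>
      simp only [Sym2.map_mk, prependBit_apply, Sym2.eq_iff, cons_inj] at h
      rcases h with ⟨⟨rfl, rfl⟩, ⟨rfl, rfl⟩⟩ | ⟨⟨rfl, rfl⟩, ⟨rfl, rfl⟩⟩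
      · exact ⟨rfl, rfl, he⟩
      · exact ⟨rfl, rfl, by rwa [Sym2.eq_swap]⟩
  · rintro ⟨rfl, rfl, h⟩
    exact ⟨_, h, rfl⟩

theorem mem_bcdcCross {m : ℕ} {b c : Bool} {u v : BitVec m} :
    s(BitVec.cons b u, BitVec.cons c v) ∈ bcdcCross m ↔
      b ≠ c ∧ (crossedCube (m + 1)).Adj (BitVec.cons b u) (BitVec.cons c v) := by
  constructor
  · rintro ⟨p, q, h, hpq⟩
    simp only [prependBit_apply, Sym2.eq_iff, cons_inj] at h hpq
    rcases h with ⟨⟨rfl, rfl⟩, ⟨rfl, rfl⟩⟩ | ⟨⟨rfl, rfl⟩, ⟨rfl, rfl⟩⟩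
    · exact ⟨by simp, hpq⟩
    · exact ⟨by simp, hpq.symm⟩
  · rintro ⟨h, h'⟩
    cases b <;> cases c
    · exact absurd rfl h
    · exact ⟨u, v, rfl, h'⟩
    · exact ⟨v, u, Sym2.eq_swap, h'.symm⟩
    · exact absurd rfl h

theorem bcdcVerts_eq_edgeSet {n : ℕ} (hn : 2 ≤ n) : bcdcVerts n = (crossedCube n).edgeSet := by
  induction n, hn using Nat.le_induction with
  | base =>
    ext e
    induction e with
    | _ p q =>
      obtain ⟨b, c, rfl⟩ := exists_eq_cons_cons p
      obtain ⟨b', c', rfl⟩ := exists_eq_cons_cons q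
      have h0 : crossMap (BitVec.cons c 0#0) = BitVec.cons c 0#0 := by
        cases c <;> rfl
      rw [SimpleGraph.mem_edgeSet, crossedCube_adj_cons, crossedCube_adj_cons, h0,
        eq_true (Subsingleton.elim (0#0) (crossMap 0#0))]
      simp only [bcdcVerts, bitVec_two_eq_cons, crossedCube, SimpleGraph.bot_adj, and_false,
        false_or, and_true, cons_inj]
      revert b c b' c'
      decide
  | succ n hn ih =>
    obtain ⟨m, rfl⟩ := Nat.exists_eq_add_of_le' hn
    ext e
    induction e with
    | _ p q =>
      obtain ⟨b, u, rfl⟩ := exists_eq_cons p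
      obtain ⟨c, v, rfl⟩ := exists_eq_cons q
      simp only [bcdcVerts, Set.mem_union, mem_map_prependBit_image, mem_bcdcCross, ih,
        SimpleGraph.mem_edgeSet, crossedCube_adj_cons (m := m + 2)]
      cases b <;> cases c <;> simp

theorem ne_and_exists_mem_of_bcdcAmbient_adj {n : ℕ} (p q : Sym2 (BitVec n))
    (h : (bcdcAmbient n).Adj p q) : p ≠ q ∧ ∃ x, x ∈ p ∧ x ∈ q := by
  refine ⟨h.ne, ?_⟩
  match n, p, q, h with
  | 0, _, _, h => exact h.elim
  | 1, _, _, h => exact h.elim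
  | 2, p, q, h =>
    simp only [bcdcAmbient, SimpleGraph.fromEdgeSet_adj, Set.mem_insert_iff,
      Set.mem_singleton_iff, Sym2.eq_iff] at h
    rcases h with ⟨(⟨rfl, rfl⟩ | ⟨rfl, rfl⟩) | (⟨rfl, rfl⟩ | ⟨rfl, rfl⟩) |
      (⟨rfl, rfl⟩ | ⟨rfl, rfl⟩) | (⟨rfl, rfl⟩ | ⟨rfl, rfl⟩), -⟩ <;> simp
  | m + 3, p, q, h =>
    have key : ∀ (b : Bool) (p q : Sym2 (BitVec (m + 2))), (bcdcAmbient (m + 2)).Adj p q →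
        ∃ x, x ∈ p.map (prependBit b (m + 2)) ∧ x ∈ q.map (prependBit b (m + 2)) := by
      intro b p q h
      obtain ⟨-, x, hp, hq⟩ := ne_and_exists_mem_of_bcdcAmbient_adj p q h
      exact ⟨_, Sym2.mem_map.2 ⟨x, hp, rfl⟩, Sym2.mem_map.2 ⟨x, hq, rfl⟩⟩
    rcases h with ((⟨-, x, y, h, rfl, rfl⟩ | ⟨-, x, y, h, rfl, rfl⟩) |
      ⟨-, (⟨s, t, r, k, rfl, -, rfl, -, h⟩ | ⟨s, t, r, k, rfl, -, rfl, -, h⟩)⟩) |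
      ⟨-, (⟨s, t, r, k, rfl, -, rfl, -, h⟩ | ⟨s, t, r, k, rfl, -, rfl, -, h⟩)⟩
    · exact key _ _ _ h
    · exact key _ _ _ h
    all_goals rcases h with rfl | rfl <;> simp

theorem bcdcAmbient_adj_of_ne_of_mem {n : ℕ} (hn : 2 ≤ n) (p q : Sym2 (BitVec n))
    (hp : p ∈ bcdcVerts n) (hq : q ∈ bcdcVerts n) (hpq : p ≠ q) (h : ∃ x, x ∈ p ∧ x ∈ q) :
    (bcdcAmbient n).Adj p q := by
  induction n, hn using Nat.le_induction with
  | base =>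
    simp only [bcdcVerts, Set.mem_insert_iff, Set.mem_singleton_iff] at hp hq
    simp only [bcdcAmbient, SimpleGraph.fromEdgeSet_adj, Set.mem_insert_iff,
      Set.mem_singleton_iff]
    refine ⟨?_, hpq⟩
    obtain ⟨x, hx, hx'⟩ := h
    rcases hp with rfl | rfl | rfl | rfl <;> rcases hq with rfl | rfl | rfl | rfl <;>
      first
      | exact absurd rfl hpq
      | decide
      | (exfalso
         revert hx hx'
         obtain ⟨b, c, rfl⟩ := exists_eq_cons_cons x
         revert b c
         decide)
  | succ n hn ih =>
    obtain ⟨m, rfl⟩ := Nat.exists_eq_add_of_le' hn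
    have mixed : ∀ (b : Bool) (p' : Sym2 (BitVec (m + 2))) (q : Sym2 (BitVec (m + 3))),
        p' ∈ bcdcVerts (m + 2) → q ∈ bcdcCross (m + 2) →
        (∃ x, x ∈ p'.map (prependBit b (m + 2)) ∧ x ∈ q) →
        (bcdcAmbient (m + 3)).Adj (p'.map (prependBit b (m + 2))) q := by
      rintro b p' q hp' ⟨c, d, rfl, hcd⟩ ⟨x, hx, hx'⟩
      have hq : s(prependBit false (m + 2) c, prependBit true (m + 2) d) ∈ bcdcCross (m + 2) :=
        ⟨c, d, rfl, hcd⟩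
      induction p' with
      | _ s t =>
        simp only [Sym2.map_mk, Sym2.mem_iff] at hx hx' ⊢
        have hne : s(prependBit b (m + 2) s, prependBit b (m + 2) t) ≠
            s(prependBit false (m + 2) c, prependBit true (m + 2) d) := by
          simp only [prependBit_apply, Ne, Sym2.eq_iff, cons_inj]
          rintro (⟨⟨rfl, -⟩, h, -⟩ | ⟨⟨rfl, -⟩, h, -⟩) <;> cases h
        cases b
        · refine Or.inl (Or.inr ⟨hne, Or.inl ⟨s, t, c, d, rfl, hp', rfl, hq, ?_⟩⟩)
          simp only [prependBit_apply] at hx hx'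
          rcases hx' with rfl | rfl <;> simp only [cons_inj] at hx <;> grind
        · refine Or.inr ⟨hne, Or.inl ⟨s, t, c, d, rfl, hp', rfl, hq, ?_⟩⟩
          simp only [prependBit_apply] at hx hx'
          rcases hx' with rfl | rfl <;> simp only [cons_inj] at hx <;> grind
    have pure : ∀ (b c : Bool) (p q : Sym2 (BitVec (m + 2))),
        p ∈ bcdcVerts (m + 2) → q ∈ bcdcVerts (m + 2) →
        p.map (prependBit b (m + 2)) ≠ q.map (prependBit c (m + 2)) →
        (∃ x, x ∈ p.map (prependBit b (m + 2)) ∧ x ∈ q.map (prependBit c (m + 2))) →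
        (bcdcAmbient (m + 3)).Adj (p.map (prependBit b (m + 2)))
          (q.map (prependBit c (m + 2))) := by
      rintro b c p q hp hq hpq ⟨x, hx, hx'⟩
      obtain ⟨y, hy, rfl⟩ := Sym2.mem_map.1 hx
      obtain ⟨z, hz, hzy⟩ := Sym2.mem_map.1 hx'
      obtain ⟨rfl, rfl⟩ := cons_inj.1 hzy
      have := ih p q hp hq (fun h => hpq (by rw [h])) ⟨_, hy, hz⟩
      cases c
      · exact Or.inl (Or.inl (Or.inl ⟨hpq, _, _, this, rfl, rfl⟩))
      · exact Or.inl (Or.inl (Or.inr ⟨hpq, _, _, this, rfl, rfl⟩))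
    have h' : ∃ x, x ∈ q ∧ x ∈ p := h.imp fun _ => And.symm
    rcases hp with (⟨p, hp, rfl⟩ | ⟨p, hp, rfl⟩) | hp <;>
      rcases hq with (⟨q, hq, rfl⟩ | ⟨q, hq, rfl⟩) | hq
    · exact pure _ _ _ _ hp hq hpq h
    · exact pure _ _ _ _ hp hq hpq h
    · exact mixed _ _ _ hp hq h
    · exact pure _ _ _ _ hp hq hpq h
    · exact pure _ _ _ _ hp hq hpq h
    · exact mixed _ _ _ hp hq h
    · exact (mixed _ _ _ hq hp h').symm
    · exact (mixed _ _ _ hq hp h').symm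
    -- Cross edges form a matching, so two of them with a common end coincide; this agrees with
    -- $S_n$ being independent.
    · obtain ⟨c, d, rfl, hcd⟩ := hp
      obtain ⟨c', d', rfl, hcd'⟩ := hq
      obtain ⟨x, hx, hx'⟩ := h
      simp only [prependBit_apply, crossedCube_adj_cons] at hcd hcd'
      simp only [prependBit_apply, Sym2.mem_iff] at hx hx' hpq
      have hd : d = crossMap c := by simpa using hcd
      have hd' : d' = crossMap c' := by simpa using hcd'
      subst hd hd'
      refine absurd ?_ hpq
      rcases hx with rfl | rfl <;> rcases hx' with hx' | hx' <;>
        simp only [cons_inj, crossMap_injective.eq_iff] at hx'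
      · rw [hx'.2]
      · cases hx'.1
      · cases hx'.1
      · rw [hx'.2]

theorem structureConnectivity_bcdc {W : Type*} {n : ℕ} (hn : 2 ≤ n) (C : SimpleGraph W) :
    structureConnectivity (bcdc n) C = structureConnectivity (crossedCube n).lineGraph C := by
  have hadj : ∀ p q : bcdcVerts n, (bcdc n).Adj p q ↔
      p ≠ q ∧ ∃ x, x ∈ (p : Sym2 (BitVec n)) ∧ x ∈ (q : Sym2 (BitVec n)) := by
    intro p q
    rw [← Subtype.coe_ne_coe]
    exact ⟨ne_and_exists_mem_of_bcdcAmbient_adj _ _, fun h =>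
      bcdcAmbient_adj_of_ne_of_mem hn _ _ p.2 q.2 h.1 h.2⟩
  -- The two vertex types agree only through `hE`. Once the graph is replaced by an arbitrary one
  -- with the same adjacency rule, the vertex set can be rewritten.
  generalize bcdc n = B at hadj
  have hE := bcdcVerts_eq_edgeSet hn
  revert B
  rw [hE]
  intro B hadj
  congr 1
  ext p q
  rw [hadj, SimpleGraph.lineGraph_adj_iff_exists]

/-! ### Claws and ladders in the crossed cube -/

/-- Three neighbours `a`, `x`, `c` of `u` and a common neighbour `w` of `a` and `x`. -/
structure IsClaw {V : Type*} (G : SimpleGraph V) (u a x c w : V) : Prop where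
  adj_a : G.Adj u a
  adj_x : G.Adj u x
  adj_c : G.Adj u c
  adj_aw : G.Adj a w
  adj_xw : G.Adj x w
  ne_ax : a ≠ x
  ne_ca : c ≠ a
  ne_cx : c ≠ x
  ne_wu : w ≠ u

/-- An edge `uv` in two 4-cycles `u a b v` and `u c d v`, where `a` and `b` are in further
4-cycles `u a w x` and `v b z y`. -/
structure IsLadder {V : Type*} (G : SimpleGraph V) (u a x c w v b y d z : V) : Prop where
  left : IsClaw G u a x c w
  right : IsClaw G v b y d z
  adj : G.Adj u v
  adj_ab : G.Adj a b
  adj_cd : G.Adj c d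
  ne_av : a ≠ v
  ne_xv : x ≠ v
  ne_cv : c ≠ v
  ne_bu : b ≠ u
  ne_yu : y ≠ u
  ne_du : d ≠ u

theorem IsLadder.symm {V : Type*} {G : SimpleGraph V} {u a x c w v b y d z : V}
    (h : IsLadder G u a x c w v b y d z) : IsLadder G v b y d z u a x c w :=
  ⟨h.right, h.left, h.adj.symm, h.adj_ab.symm, h.adj_cd.symm, h.ne_bu, h.ne_yu, h.ne_du, h.ne_av,
    h.ne_xv, h.ne_cv⟩

/-- For such strings the cross edge only flips the leading bit, so an edge between two of them
extends to a 4-cycle across the halves. -/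
theorem crossMap_eq_self {m : ℕ} {u : BitVec m}
    (hu : ∀ i, i % 2 = 0 → u.getLsbD i = false) : crossMap u = u := by
  apply BitVec.eq_of_getLsbD_eq
  intro i hi
  rw [getLsbD_crossMap _ _ hi]
  by_cases h : i % 2 = 1
  · simp only [hu (i - 1) (by omega), Bool.and_false, Bool.xor_false]
  · simp only [h, decide_false, Bool.false_and, Bool.xor_false]

theorem IsClaw.cons {m : ℕ} {u a x c w : BitVec m} (h : IsClaw (crossedCube m) u a x c w)
    (b : Bool) : IsClaw (crossedCube (m + 1)) (BitVec.cons b u) (BitVec.cons b a)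
      (BitVec.cons b x) (BitVec.cons b c) (BitVec.cons b w) := by
  constructor <;> simp only [crossedCube_adj_cons, ne_eq, cons_inj, true_and, not_true,
    false_and, or_false]
  exacts [h.adj_a, h.adj_x, h.adj_c, h.adj_aw, h.adj_xw, h.ne_ax, h.ne_ca, h.ne_cx, h.ne_wu]

/-- The vertices $u,a,c$ have to be fixed by `crossMap`, since the two squares of the ladder stand
on $ua$ and $uc$; $x$ and $w$ are only used inside their half. The witnesses for $m=4$ are
$0000,0010,0001,1000,0011$. -/
theorem exists_isClaw_crossedCube {m : ℕ} (hm : 4 ≤ m) : ∃ u a x c w : BitVec m,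
    IsClaw (crossedCube m) u a x c w ∧ (∀ i, i % 2 = 0 → u.getLsbD i = false) ∧
      (∀ i, i % 2 = 0 → a.getLsbD i = false) ∧ ∀ i, i % 2 = 0 → c.getLsbD i = false := by
  induction m, hm using Nat.le_induction with
  | base =>
    let t (b₃ b₂ b₁ b₀ : Bool) : BitVec (0 + 1 + 1 + 1 + 1) :=
      BitVec.cons b₃ (BitVec.cons b₂ (BitVec.cons b₁ (BitVec.cons b₀ 0#0)))
    refine ⟨t false false false false, t false false true false, t false false false true,
      t true false false false, t false false true true, ?_, ?_⟩
    · change IsClaw (crossedCube (0 + 1 + 1 + 1 + 1)) _ _ _ _ _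
      have h0 : (crossedCube 0).Adj 0#0 0#0 ↔ False := Iff.rfl
      constructor <;> simp only [t, ne_eq, crossedCube_adj_cons, cons_inj, h0] <;> decide
    · have h : ∀ u : BitVec 4, (∀ i < 4, i % 2 = 0 → u.getLsbD i = false) →
          ∀ i, i % 2 = 0 → u.getLsbD i = false := fun u hu i hi => by
        by_cases h4 : i < 4
        · exact hu i h4 hi
        · exact BitVec.getLsbD_of_ge _ _ (by omega)
      exact ⟨h _ (by decide), h _ (by decide), h _ (by decide)⟩
  | succ m hm ih =>
    obtain ⟨u, a, x, c, w, h, hu, ha, hc⟩ := ih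
    have key : ∀ t : BitVec m, (∀ i, i % 2 = 0 → t.getLsbD i = false) →
        ∀ i, i % 2 = 0 → (BitVec.cons false t).getLsbD i = false := fun t ht i hi => by
      rw [BitVec.getLsbD_cons, ht i hi, ite_self]
    exact ⟨_, _, _, _, _, h.cons false, key u hu, key a ha, key c hc⟩

theorem exists_isLadder_crossedCube {n : ℕ} (hn : 5 ≤ n) :
    ∃ u a x c w v b y d z : BitVec n, IsLadder (crossedCube n) u a x c w v b y d z := by
  obtain ⟨m, rfl⟩ := Nat.exists_eq_add_of_le' (Nat.one_le_of_lt hn)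
  obtain ⟨u, a, x, c, w, h, hu, ha, hc⟩ := exists_isClaw_crossedCube (m := m) (by omega)
  refine ⟨_, _, _, _, _, _, _, _, _, _, h.cons false, h.cons true,
    (crossedCube_adj_cons _ _ _ _).2 (Or.inr ⟨Bool.false_ne_true, (crossMap_eq_self hu).symm⟩),
    (crossedCube_adj_cons _ _ _ _).2 (Or.inr ⟨Bool.false_ne_true, (crossMap_eq_self ha).symm⟩),
    (crossedCube_adj_cons _ _ _ _).2 (Or.inr ⟨Bool.false_ne_true, (crossMap_eq_self hc).symm⟩),
    ?_, ?_, ?_, ?_, ?_, ?_⟩ <;> simp [cons_inj]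

/-! ### Cycles of the line graph against stars -/

open scoped Fin.NatCast Fin.CommRing in
theorem Fin.eq_univ_of_add_one_mem {m : ℕ} (P : Set (Fin (m + 1))) (hP : P.Nonempty)
    (h : ∀ i ∈ P, i + 1 ∈ P) : P = Set.univ := by
  obtain ⟨i, hi⟩ := hP
  have key : ∀ t : ℕ, i + (t : Fin (m + 1)) ∈ P := by
    intro t
    induction t with
    | zero => simpa using hi
    | succ t ih =>
      have := h _ ih
      rwa [add_assoc, ← Nat.cast_succ] at this
  refine Set.eq_univ_of_forall fun j => ?_
  have := key (j - i).val
  rwa [Fin.cast_val_eq_self, add_sub_cancel] at this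

/-- In a cycle, two nonempty disjoint sets of vertices without edges between them miss at least
two vertices. -/
theorem Fin.ncard_add_ncard_add_two_le {m : ℕ} (P Q : Set (Fin (m + 1))) (hP : P.Nonempty)
    (hQ : Q.Nonempty) (hPQ : Disjoint P Q) (h : ∀ i ∈ P, i + 1 ∉ Q) (h' : ∀ i ∈ Q, i + 1 ∉ P) :
    P.ncard + Q.ncard + 2 ≤ m + 1 := by
  have exit : ∀ R : Set (Fin (m + 1)), R.Nonempty → R ≠ Set.univ → ∃ i ∈ R, i + 1 ∉ R := by
    intro R hR hne
    by_contra! hc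
    exact hne (Fin.eq_univ_of_add_one_mem R hR hc)
  obtain ⟨i, hi, hi'⟩ := exit P hP (by
    rintro rfl
    obtain ⟨j, hj⟩ := hQ
    exact Set.disjoint_left.1 hPQ (Set.mem_univ j) hj)
  obtain ⟨j, hj, hj'⟩ := exit Q hQ (by
    rintro rfl
    obtain ⟨j, hj⟩ := hP
    exact Set.disjoint_left.1 hPQ hj (Set.mem_univ j))
  -- The two missed vertices are the successors of an exit from `P` and of an exit from `Q`; if they
  -- coincided, so would the exits.
  have hij : i + 1 ≠ j + 1 := by
    intro e
    obtain rfl := add_right_cancel e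
    exact Set.disjoint_left.1 hPQ hi hj
  have hd : Disjoint (P ∪ Q) {i + 1, j + 1} := by
    rw [Set.disjoint_right]
    rintro _ (rfl | rfl) (hx | hx)
    · exact hi' hx
    · exact h i hi hx
    · exact h' j hj hx
    · exact hj' hx
  have := Set.ncard_le_card (P ∪ Q ∪ {i + 1, j + 1})
  rwa [Set.ncard_union_eq hd (Set.toFinite _) (Set.toFinite _),
    Set.ncard_union_eq hPQ (Set.toFinite _) (Set.toFinite _), Set.ncard_pair hij,
    Nat.card_fin] at this

section

variable {V : Type*} {G : SimpleGraph V}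

/-- The edges of `G` at the vertex `u`, as vertices of the line graph. -/
def edgeStar (G : SimpleGraph V) (u : V) : Set G.edgeSet := {e | u ∈ (e : Sym2 V)}

theorem mem_edgeStar {u : V} {e : G.edgeSet} : e ∈ edgeStar G u ↔ u ∈ (e : Sym2 V) := Iff.rfl

theorem ncard_edgeStar (u : V) : (edgeStar G u).ncard = (G.neighborSet u).ncard := by
  classical
  have : Subtype.val '' edgeStar G u = G.incidenceSet u := by
    ext e
    simp [edgeStar, SimpleGraph.incidenceSet, and_comm]
  rw [← Set.ncard_image_of_injective _ Subtype.val_injective, this]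
  exact Nat.card_congr (G.incidenceSetEquivNeighborSet u)

theorem lineGraph_adj_of_mem {e f : G.edgeSet} (h : e ≠ f) {x : V} (he : x ∈ (e : Sym2 V))
    (hf : x ∈ (f : Sym2 V)) : G.lineGraph.Adj e f :=
  SimpleGraph.lineGraph_adj_iff_exists.2 ⟨h, x, he, hf⟩

theorem exists_cyclic_enumeration {W : Type*} {H : SimpleGraph W} {S : H.Subgraph} {m : ℕ}
    (hS : Nonempty (S.coe ≃g SimpleGraph.cycleGraph (m + 2))) :
    ∃ f : Fin (m + 2) → W, Function.Injective f ∧ Set.range f = S.verts ∧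
      ∀ i, H.Adj (f i) (f (i + 1)) := by
  obtain ⟨φ⟩ := hS
  refine ⟨fun i => (φ.symm i).1, Subtype.val_injective.comp φ.symm.injective, ?_, fun i => ?_⟩
  · rw [show (fun i => (φ.symm i).1) = Subtype.val ∘ φ.symm from rfl, Set.range_comp,
      EquivLike.range_eq_univ]
    simp
  · refine S.adj_sub (φ.symm.map_adj_iff.2 ?_)
    rw [SimpleGraph.cycleGraph_adj]
    exact Or.inr (add_sub_cancel_left _ _)

theorem ncard_verts_of_iso_cycleGraph {W : Type*} {H : SimpleGraph W} {S : H.Subgraph} {k : ℕ}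
    (hS : Nonempty (S.coe ≃g SimpleGraph.cycleGraph k)) : S.verts.ncard = k := by
  obtain ⟨φ⟩ := hS
  exact (Nat.card_congr φ.toEquiv).trans (Nat.card_fin k)

theorem ncard_verts_inter_eq {W : Type*} {S : Set W} {m : ℕ} {f : Fin m → W}
    (hf : Function.Injective f) (hS : Set.range f = S) (A : Set W) :
    (S ∩ A).ncard = (f ⁻¹' A).ncard := by
  rw [← Set.ncard_image_of_injective _ hf, Set.image_preimage_eq_range_inter, hS]

/-- A common end of an edge at $u$ and an edge at $v$, both different from $uv$, would form a
triangle with $u$ and $v$. -/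
theorem edgeStars_no_adj (hG : ∀ x y z, G.Adj x y → G.Adj y z → G.Adj x z → False)
    {u v : V} (huv : G.Adj u v) {e f : G.edgeSet}
    (he : e.1 ≠ s(u, v)) (hf : f.1 ≠ s(u, v)) (hu : u ∈ e.1) (hv : v ∈ f.1) :
    ¬ G.lineGraph.Adj e f := by
  intro h
  obtain ⟨-, x, hx, hx'⟩ := SimpleGraph.lineGraph_adj_iff_exists.1 h
  obtain ⟨e, he'⟩ := e
  obtain ⟨f, hf'⟩ := f
  simp only at *
  obtain ⟨a, rfl⟩ := Sym2.mem_iff_exists.1 hu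
  obtain ⟨b, rfl⟩ := Sym2.mem_iff_exists.1 hv
  rw [SimpleGraph.mem_edgeSet] at he' hf'
  rw [Sym2.mem_iff] at hx hx'
  rcases hx with rfl | rfl
  · rcases hx' with rfl | rfl
    · exact huv.ne rfl
    · exact hf Sym2.eq_swap
  · rcases hx' with rfl | rfl
    · exact he rfl
    · exact hG u v x huv hf' he'
end

section

variable {V : Type*} {G : SimpleGraph V}

theorem ncard_edgeStar_add_two_le (hG : ∀ x y z, G.Adj x y → G.Adj y z → G.Adj x z → False)
    {k : ℕ} (hk : 3 ≤ k) {S : G.lineGraph.Subgraph}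
    (hS : Nonempty (S.coe ≃g SimpleGraph.cycleGraph k)) {u v : V} (huv : G.Adj u v)
    (he : ∀ e ∈ S.verts, e.1 ≠ s(u, v)) (hu : (S.verts ∩ edgeStar G u).Nonempty)
    (hv : (S.verts ∩ edgeStar G v).Nonempty) :
    (S.verts ∩ edgeStar G u).ncard + (S.verts ∩ edgeStar G v).ncard + 2 ≤ k := by
  obtain ⟨m, rfl⟩ := Nat.exists_eq_add_of_le' (Nat.le_of_succ_le hk)
  obtain ⟨f, hf, hfS, hadj⟩ := exists_cyclic_enumeration hS
  have he' : ∀ i, (f i).1 ≠ s(u, v) := fun i => he _ (hfS ▸ Set.mem_range_self i)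
  rw [ncard_verts_inter_eq hf hfS, ncard_verts_inter_eq hf hfS]
  have hne : ∀ w, (S.verts ∩ edgeStar G w).Nonempty → (f ⁻¹' edgeStar G w).Nonempty := by
    rintro w ⟨e, h1, h2⟩
    rw [← hfS] at h1
    obtain ⟨i, rfl⟩ := h1
    exact ⟨i, h2⟩
  refine Fin.ncard_add_ncard_add_two_le _ _ (hne u hu) (hne v hv) ?_ ?_ ?_
  · rw [Set.disjoint_left]
    intro i hi hi'
    exact he' i (((Sym2.mem_and_mem_iff huv.ne).1 ⟨hi, hi'⟩))
  · exact fun i hi hi' => edgeStars_no_adj hG huv (he' i) (he' _) hi hi' (hadj i)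
  · exact fun i hi hi' => edgeStars_no_adj hG huv (he' _) (he' i) hi' hi (hadj i).symm

open scoped Fin.CommRing in
-- A single cycle vertex outside the star of $u$ would have two neighbours $ua\ne ub$ on the cycle.
-- Avoiding $u$, it would be the edge $ab$, closing a triangle.
theorem ncard_edgeStar_add_one_ne (hG : ∀ x y z, G.Adj x y → G.Adj y z → G.Adj x z → False)
    {k : ℕ} (hk : 3 ≤ k) {S : G.lineGraph.Subgraph}
    (hS : Nonempty (S.coe ≃g SimpleGraph.cycleGraph k)) (u : V) :
    (S.verts ∩ edgeStar G u).ncard + 1 ≠ k := by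
  obtain ⟨m, rfl⟩ := Nat.exists_eq_add_of_le' hk
  obtain ⟨f, hf, hfS, hadj⟩ := exists_cyclic_enumeration (m := m + 1) hS
  rw [ncard_verts_inter_eq hf hfS]
  intro h
  have hc := Set.ncard_add_ncard_compl (f ⁻¹' edgeStar G u)
  rw [Nat.card_fin] at hc
  obtain ⟨i, hi⟩ := Set.ncard_eq_one.1 (show (f ⁻¹' edgeStar G u)ᶜ.ncard = 1 by omega)
  have h1 : (1 : Fin (m + 1 + 2)) ≠ 0 := by simp
  -- Here $k\ge3$ is used: predecessor and successor on the cycle differ.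
  have h2 : (1 : Fin (m + 1 + 2)) + 1 ≠ 0 := by
    intro h
    have := congrArg Fin.val h
    rw [Fin.val_add, Fin.val_one, Nat.mod_eq_of_lt (by omega)] at this
    exact absurd this (by simp)
  have mem : ∀ j, j ≠ i → u ∈ (f j).1 := by
    intro j hj
    by_contra hn
    have : j ∈ (f ⁻¹' edgeStar G u)ᶜ := hn
    rw [hi] at this
    exact hj this
  have hui : u ∉ (f i).1 := by
    have : i ∈ (f ⁻¹' edgeStar G u)ᶜ := by simp [hi]
    exact this
  have key : ∀ j, j ≠ i → G.lineGraph.Adj (f j) (f i) →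
      ∃ a, (f j).1 = s(u, a) ∧ a ∈ (f i).1 ∧ G.Adj u a := by
    intro j hj hadj
    obtain ⟨a, ha⟩ := Sym2.mem_iff_exists.1 (mem j hj)
    obtain ⟨-, x, hx, hx'⟩ := SimpleGraph.lineGraph_adj_iff_exists.1 hadj
    rw [ha, Sym2.mem_iff] at hx
    have hG' := (f j).2
    rw [ha] at hG'
    rcases hx with rfl | rfl
    · exact absurd hx' hui
    · exact ⟨x, ha, hx', hG'⟩
  have hs : i - 1 ≠ i := fun h => h1 (sub_eq_self.1 h)
  have ha' : i + 1 ≠ i := fun h => h1 (add_eq_left.1 h)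
  obtain ⟨a, ha, hai, hua⟩ := key (i - 1) hs (by simpa using hadj (i - 1))
  obtain ⟨b, hb, hbi, hub⟩ := key (i + 1) ha' (hadj i).symm
  have hab : a ≠ b := by
    rintro rfl
    have := hf (Subtype.ext (ha.trans hb.symm))
    apply h2
    linear_combination -this
  have hi := (f i).2
  rw [(Sym2.mem_and_mem_iff hab).1 ⟨hai, hbi⟩] at hi
  exact hG u a b hua hi hub

/-! ### Cuts and the lower bound -/

/-- A cut of the line graph isolates an edge or contains all edges between a large set of vertices
and its large complement. -/
theorem IsSubgraphCut.exists_isolated_or_boundary [Finite V] {F : Set G.lineGraph.Subgraph}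
    (hF : IsSubgraphCut G.lineGraph F) :
    (∃ e, e ∉ familyVerts F ∧ ∀ f, G.lineGraph.Adj e f → f ∈ familyVerts F) ∨
      ∃ X : Set V, 3 ≤ X.ncard ∧ X.ncard + 3 ≤ Nat.card V ∧
        ∀ x ∈ X, ∀ y ∉ X, ∀ h : G.Adj x y, ⟨s(x, y), h⟩ ∈ familyVerts F := by
  generalize hD : familyVerts F = D
  rw [IsSubgraphCut, hD] at hF
  rcases hF with hF | ⟨e, he⟩
  swap
  · refine Or.inl ⟨e, fun h => ?_, fun f hf => ?_⟩
    · have : e ∈ Dᶜ := by rw [he]; rfl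
      exact this h
    · by_contra h
      have : f ∈ Dᶜ := h
      rw [he] at this
      exact hf.ne this.symm
  simp only [SimpleGraph.Preconnected, not_forall] at hF
  obtain ⟨⟨e, heD⟩, ⟨e', heD'⟩, hee⟩ := hF
  set K := G.lineGraph.induce Dᶜ with hK
  -- The vertices of $G$ covered by the component of `e`. A surviving edge that meets `X` belongs to
  -- this component, so it has both ends in `X`.
  let X : Set V := {x | ∃ g : ↥(Dᶜ), K.Reachable ⟨e, heD⟩ g ∧ x ∈ g.1.1}
  have reach : ∀ g : ↥(Dᶜ), ∀ x ∈ X, x ∈ g.1.1 → K.Reachable ⟨e, heD⟩ g := by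
    rintro g x ⟨g', hg', hx⟩ hxg
    by_cases h : g' = g
    · rwa [← h]
    · refine hg'.trans (SimpleGraph.Adj.reachable ?_)
      exact lineGraph_adj_of_mem (fun h' => h (Subtype.ext h')) hx hxg
  have heX : ∀ x ∈ e.1, x ∈ X := fun x hx => ⟨_, SimpleGraph.Reachable.refl _, hx⟩
  have heX' : ∀ x ∈ e'.1, x ∉ X := fun x hx hxX => hee (reach _ x hxX hx)
  -- If no surviving edge leaves a set of at most two vertices, then an edge inside the set is the
  -- only surviving edge meeting it. This applies to `X` with `e` and to its complement with `e'`.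
  have isolated : ∀ (Y : Set V) (e : G.edgeSet), Y.ncard ≤ 2 → (∀ x ∈ e.1, x ∈ Y) →
      (∀ g : ↥(Dᶜ), ∀ x ∈ g.1.1, x ∈ Y → ∀ y ∈ g.1.1, y ∈ Y) →
      ∀ f, G.lineGraph.Adj e f → f ∈ D := by
    intro Y e hY he hg f hf
    by_contra hfD
    obtain ⟨hne, x, hx, hx'⟩ := SimpleGraph.lineGraph_adj_iff_exists.1 hf
    have hf' := hg ⟨f, hfD⟩ x hx' (he x hx)
    obtain ⟨e, he2⟩ := e
    obtain ⟨f, hf2⟩ := f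
    induction e with
    | _ a b =>
    induction f with
    | _ c d =>
      simp only [Sym2.mem_iff, forall_eq_or_imp, forall_eq] at he hf'
      have hab : a ≠ b := he2.ne
      have hY' : {a, b} = Y := Set.eq_of_subset_of_ncard_le
        (by rintro _ (rfl | rfl); exacts [he.1, he.2]) (by rwa [Set.ncard_pair hab])
        (Set.toFinite _)
      rw [← hY'] at hf'
      apply hne
      have hcd : c ≠ d := hf2.ne
      rw [Subtype.mk.injEq, Sym2.eq_iff]
      rcases hf' with ⟨rfl | h1, rfl | h2⟩
      · exact absurd rfl hcd
      · exact Or.inl ⟨rfl, h2.symm⟩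
      · exact Or.inr ⟨rfl, h1.symm⟩
      · exact absurd (h1.trans h2.symm) hcd
  have hcard := Set.ncard_add_ncard_compl X
  by_cases h1 : X.ncard ≤ 2
  · exact Or.inl ⟨e, heD, isolated X e h1 heX fun g x hx hxX y hy => ⟨g, reach g x hxX hx, hy⟩⟩
  by_cases h2 : Xᶜ.ncard ≤ 2
  · exact Or.inl ⟨e', heD', isolated Xᶜ e' h2 heX' fun g x hx hxX y hy hyX =>
      hxX ⟨g, reach g y hyX hy, hx⟩⟩
  · refine Or.inr ⟨X, by omega, by omega, fun x hx y hy h => ?_⟩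
    by_contra hxy
    exact hy ⟨⟨_, hxy⟩, reach ⟨_, hxy⟩ x hx (Sym2.mem_mk_left x y), Sym2.mem_mk_right x y⟩

theorem ncard_boundaryPairs_le [Finite V] {X : Set V} {D : Set G.edgeSet}
    (h : ∀ x ∈ X, ∀ y ∉ X, ∀ h : G.Adj x y, ⟨s(x, y), h⟩ ∈ D) :
    (boundaryPairs G X).ncard ≤ D.ncard := by
  rw [← Set.ncard_image_of_injective D Subtype.val_injective]
  refine Set.ncard_le_ncard_of_injOn (fun p => s(p.1, p.2)) ?_ ?_ (Set.toFinite _)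
  · rintro ⟨x, y⟩ ⟨hx, hy, hxy⟩
    exact ⟨_, h x hx y hy hxy, rfl⟩
  · rintro ⟨x, y⟩ ⟨hx, hy, hxy⟩ ⟨x', y'⟩ ⟨hx', hy', hxy'⟩ he
    rcases Sym2.eq_iff.1 he with ⟨rfl, rfl⟩ | ⟨rfl, rfl⟩
    · rfl
    · exact absurd hx hy'

theorem ncard_familyVerts_inter_le [Finite V] (T : Finset G.lineGraph.Subgraph)
    (A : Set G.edgeSet) :
    (familyVerts (T : Set G.lineGraph.Subgraph) ∩ A).ncard ≤ ∑ S ∈ T, (S.verts ∩ A).ncard := by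
  rw [familyVerts, Set.iUnion₂_inter]
  exact T.set_ncard_biUnion_le _

theorem le_sum_ncard_edgeStar [Finite V] {n : ℕ}
    (hn : ∀ x, (G.neighborSet x).ncard = n) {T : Finset G.lineGraph.Subgraph} {u v : V}
    (huv : G.Adj u v)
    (he : ∀ f, G.lineGraph.Adj ⟨s(u, v), huv⟩ f → f ∈ familyVerts (T : Set G.lineGraph.Subgraph)) :
    n - 1 ≤ ∑ S ∈ T, (S.verts ∩ edgeStar G u).ncard := by
  refine le_trans ?_ (ncard_familyVerts_inter_le T _)
  rw [← hn u, ← ncard_edgeStar, ← Set.ncard_sdiff_singleton_of_mem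
    (show ⟨s(u, v), huv⟩ ∈ edgeStar G u from Sym2.mem_mk_left u v)]
  refine Set.ncard_le_ncard ?_ (Set.toFinite _)
  rintro f ⟨hf, hf'⟩
  exact ⟨he f (lineGraph_adj_of_mem (fun h => hf' h.symm) (Sym2.mem_mk_left u v) hf), hf⟩
end

/-- Here `p i` and `q i` count the vertices of the `i`-th cycle in the two stars. One index with
both nonzero already loses $2$ from the total $k\cdot|T|$; without such an index, `T` splits
according to which end is served. -/
theorem exists_split_of_sum_le {ι : Type*} {k N : ℕ} (T : Finset ι) (p q : ι → ℕ)
    (hp : ∀ i ∈ T, p i ≤ k) (hq : ∀ i ∈ T, q i ≤ k)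
    (hpq : ∀ i ∈ T, p i = 0 ∨ q i = 0 ∨ p i + q i + 2 ≤ k)
    (hP : N ≤ ∑ i ∈ T, p i) (hQ : N ≤ ∑ i ∈ T, q i) :
    2 * N + 2 ≤ k * T.card ∨ ∃ s t, s + t = T.card ∧ N ≤ k * s ∧ N ≤ k * t := by
  classical
  have hle : ∀ i ∈ T, p i + q i ≤ k := by
    intro i hi
    have := hp i hi
    have := hq i hi
    have := hpq i hi
    omega
  by_cases h : ∃ i ∈ T, p i ≠ 0 ∧ q i ≠ 0
  · obtain ⟨i, hi, h1, h2⟩ := h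
    left
    have h3 := (hpq i hi).resolve_left h1 |>.resolve_left h2
    have h4 : ∑ j ∈ T.erase i, (p j + q j) ≤ (T.erase i).card * k :=
      Finset.sum_le_card_nsmul _ _ _ fun j hj => hle j (Finset.mem_of_mem_erase hj)
    have h5 := Finset.add_sum_erase T (fun j => p j + q j) hi
    have h7 := Finset.sum_add_distrib (s := T) (f := p) (g := q)
    have h6 := Finset.card_erase_add_one hi
    rw [← h6, mul_add, mul_one, mul_comm k]
    omega
  · push Not at h
    right
    refine ⟨(T.filter fun i => q i = 0).card, (T.filter fun i => ¬ q i = 0).card,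
      Finset.card_filter_add_card_filter_not _, ?_, ?_⟩
    · rw [← Finset.sum_filter_add_sum_filter_not T (fun i => q i = 0) p] at hP
      have : ∑ i ∈ T.filter (fun i => ¬ q i = 0), p i = 0 := by
        refine Finset.sum_eq_zero fun i hi => ?_
        rw [Finset.mem_filter] at hi
        by_contra hne
        exact hi.2 (h i hi.1 hne)
      rw [this, add_zero] at hP
      refine hP.trans ?_
      rw [mul_comm]
      exact Finset.sum_le_card_nsmul _ _ _ fun j hj => hp j (Finset.mem_of_mem_filter j hj)
    · rw [← Finset.sum_filter_add_sum_filter_not T (fun i => q i = 0) q] at hQ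
      rw [Finset.sum_eq_zero (s := T.filter fun i => q i = 0)
        fun i hi => (Finset.mem_filter.1 hi).2, zero_add] at hQ
      refine hQ.trans ?_
      rw [mul_comm]
      exact Finset.sum_le_card_nsmul _ _ _ fun j hj => hq j (Finset.mem_of_mem_filter j hj)

section

variable {V : Type*} {G : SimpleGraph V}

theorem familyVerts_ncard_le [Finite V] {k : ℕ} {T : Finset G.lineGraph.Subgraph}
    (hT : ∀ S ∈ T, Nonempty (S.coe ≃g SimpleGraph.cycleGraph k)) :
    (familyVerts (T : Set G.lineGraph.Subgraph)).ncard ≤ k * T.card := by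
  have := ncard_familyVerts_inter_le T Set.univ
  rw [Set.inter_univ] at this
  refine this.trans ?_
  rw [mul_comm]
  refine Finset.sum_le_card_nsmul _ _ _ fun S hS => ?_
  rw [Set.inter_univ, ncard_verts_of_iso_cycleGraph (hT S hS)]

theorem IsStructureCut.card_bounds [Finite V] {n k : ℕ} (hn : 1 ≤ n) (hk : 3 ≤ k)
    (hreg : ∀ x, (G.neighborSet x).ncard = n)
    (hG : ∀ x y z, G.Adj x y → G.Adj y z → G.Adj x z → False)
    (hB : ∀ X : Set V, 3 ≤ X.ncard → X.ncard + 3 ≤ Nat.card V →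
      2 * n + 1 ≤ (boundaryPairs G X).ncard)
    {T : Finset G.lineGraph.Subgraph}
    (hT : IsStructureCut G.lineGraph (SimpleGraph.cycleGraph k)
      (T : Set G.lineGraph.Subgraph)) :
    (2 * n ≤ k * T.card ∨ ∃ s t, s + t = T.card ∧ n - 1 ≤ k * s ∧ n - 1 ≤ k * t) ∧
      (k = n → 3 ≤ T.card) := by
  have h2n : 2 * (n - 1) + 2 = 2 * n := by omega
  obtain ⟨hcut, hiso⟩ := hT
  rcases hcut.exists_isolated_or_boundary with ⟨e, he, hadj⟩ | ⟨X, h1, h2, h3⟩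
  · obtain ⟨e, he'⟩ := e
    induction e with
    | _ u v =>
      have huv : G.Adj u v := he'
      have hP := le_sum_ncard_edgeStar hreg huv hadj
      have hQ := le_sum_ncard_edgeStar hreg huv.symm (T := T) (by simpa only [Sym2.eq_swap])
      have hmem : ∀ S ∈ T, ∀ f ∈ S.verts, f.1 ≠ s(u, v) := by
        intro S hS f hf hfe
        refine he (Set.mem_biUnion (x := S) hS ?_)
        convert hf
        exact hfe.symm
      have hle : ∀ w, ∀ S ∈ T, (S.verts ∩ edgeStar G w).ncard ≤ k := by
        intro w S hS
        rw [← ncard_verts_of_iso_cycleGraph (hiso S hS)]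
        exact Set.ncard_le_ncard Set.inter_subset_left (Set.toFinite _)
      have hpq : ∀ S ∈ T, (S.verts ∩ edgeStar G u).ncard = 0 ∨
          (S.verts ∩ edgeStar G v).ncard = 0 ∨
          (S.verts ∩ edgeStar G u).ncard + (S.verts ∩ edgeStar G v).ncard + 2 ≤ k := by
        intro S hS
        by_cases hu : (S.verts ∩ edgeStar G u).Nonempty
        · by_cases hv : (S.verts ∩ edgeStar G v).Nonempty
          · exact Or.inr (Or.inr (ncard_edgeStar_add_two_le hG hk (hiso S hS) huv (hmem S hS)
              hu hv))
          · rw [Set.not_nonempty_iff_eq_empty] at hv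
            simp [hv]
        · rw [Set.not_nonempty_iff_eq_empty] at hu
          simp [hu]
      refine ⟨?_, ?_⟩
      · have := exists_split_of_sum_le T _ _ (hle u) (hle v) hpq hP hQ
        rwa [h2n] at this
      · rintro rfl
        -- At most $n-1=k-1$ because $uv$ is avoided, and $k-1$ itself is impossible for a cycle.
        have hlt : ∀ w w', s(w, w') = s(u, v) → ∀ S ∈ T,
            (S.verts ∩ edgeStar G w).ncard + 2 ≤ k := by
          intro w w' hw S hS
          have hww : G.Adj w w' := by rwa [← SimpleGraph.mem_edgeSet, hw]
          have h1 := ncard_edgeStar_add_one_ne hG hk (hiso S hS) w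
          have h2 : (S.verts ∩ edgeStar G w).ncard ≤ k - 1 := by
            rw [← hreg w, ← ncard_edgeStar, ← Set.ncard_sdiff_singleton_of_mem
              (show ⟨s(w, w'), hww⟩ ∈ edgeStar G w from Sym2.mem_mk_left w w')]
            refine Set.ncard_le_ncard ?_ (Set.toFinite _)
            rintro f ⟨hf, hf'⟩
            refine ⟨hf', fun h => hmem S hS f hf ?_⟩
            exact (congrArg Subtype.val (Set.mem_singleton_iff.1 h)).trans hw
          omega
        have hsum : ∑ S ∈ T, ((S.verts ∩ edgeStar G u).ncard + (S.verts ∩ edgeStar G v).ncard) ≤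
            T.card * (k - 2) := by
          refine Finset.sum_le_card_nsmul _ _ _ fun S hS => ?_
          have h1 := hlt u v rfl S hS
          have h2 := hlt v u Sym2.eq_swap S hS
          have h3 := hpq S hS
          omega
        rw [Finset.sum_add_distrib] at hsum
        by_contra! h
        have := hsum.trans (Nat.mul_le_mul_right _ (Nat.le_of_lt_succ h))
        omega
  · have := (hB X h1 h2).trans ((ncard_boundaryPairs_le h3).trans (familyVerts_ncard_le hiso))
    -- The surplus of $2n+1$ over $2n$ is what excludes two cycles of length $k=n$.
    refine ⟨Or.inl (by omega), ?_⟩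
    rintro rfl
    by_contra! h
    have := this.trans (Nat.mul_le_mul_left _ (Nat.le_of_lt_succ h))
    omega

end

/-! ### Arithmetic of the lower bound -/

theorem ceil_div_le_iff {n k m : ℕ} (hn : 1 ≤ n) (hk : 0 < k) :
    ⌈((n : ℚ) - 1) / (k : ℚ)⌉₊ ≤ m ↔ n - 1 ≤ k * m := by
  rw [Nat.ceil_le, div_le_iff₀ (by exact_mod_cast hk), ← Nat.cast_one, ← Nat.cast_sub hn,
    mul_comm k m]
  exact_mod_cast Iff.rfl

theorem structure_count_le {n k r t : ℕ} (hn : 5 ≤ n) (hk : 6 ≤ k) (hkn : k ≤ 2 * n)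
    (hr : r = (n - 1) % k)
    (h : 2 * n ≤ k * t ∨ ∃ s s', s + s' = t ∧ n - 1 ≤ k * s ∧ n - 1 ≤ k * s')
    (h3 : k = n → 3 ≤ t) :
    (if (6 ≤ k ∧ k ≤ n - 1 ∧ 1 ≤ r ∧ r ≤ k / 2 - 1) ∨ k = 2 * n then
          2 * ⌈((n : ℚ) - 1) / (k : ℚ)⌉₊ - 1
        else if k = n then 3
        else 2 * ⌈((n : ℚ) - 1) / (k : ℚ)⌉₊ : ℕ) ≤ t := by
  have hq := fun m => ceil_div_le_iff (m := m) (show 1 ≤ n by omega) (show 0 < k by omega)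
  generalize ⌈((n : ℚ) - 1) / (k : ℚ)⌉₊ = q at hq
  obtain ⟨d, rfl⟩ : ∃ d, q = d + 1 := by
    refine Nat.exists_eq_succ_of_ne_zero ?_
    rintro rfl
    have := (hq 0).1 le_rfl
    omega
  -- With $q=d+1$ the ceiling, $kd<n-1\le k(d+1)$. A split costs $2q$ cycles, so fewer than $2q$ are
  -- possible only through $2n\le kt$.
  have hd : k * d < n - 1 := by
    by_contra! hc
    have := (hq d).2 hc
    omega
  have hsplit : (∃ s s', s + s' = t ∧ n - 1 ≤ k * s ∧ n - 1 ≤ k * s') → 2 * (d + 1) ≤ t := by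
    rintro ⟨s, s', h1, h2, h3⟩
    have := (hq s).2 h2
    have := (hq s').2 h3
    omega
  have hmul : ∀ m, t ≤ m → k * t ≤ k * m := fun m hm => Nat.mul_le_mul_left k hm
  have e1 : k * (2 * d) = 2 * (k * d) := by ring
  have e2 : k * (2 * d + 1) = 2 * (k * d) + k := by ring
  split_ifs with hc hkn'
  · by_contra! hlt
    have h1 := hmul (2 * d) (by omega)
    have h2 := h.resolve_right fun h => by have := hsplit h; omega
    omega
  · exact h3 hkn'
  · by_contra! hlt
    have h1 := hmul (2 * d + 1) (by omega)
    have h2 := h.resolve_right fun h => by have := hsplit h; omega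
    -- Now $2n\le k(2d+1)$ reads $2(n-1-kd)+2\le k$. This makes $n-1-kd$ the remainder and puts it
    -- in the excluded range if $d>0$; for $d=0$ it says $k=2n$.
    have hr' : r = n - 1 - k * d := by
      rw [hr]
      have : n - 1 = (n - 1 - k * d) + k * d := by omega
      rw [this, Nat.add_mul_mod_self_left, Nat.mod_eq_of_lt (by omega)]
      omega
    apply hc
    rcases Nat.eq_zero_or_pos d with rfl | hd0
    · right
      omega
    · left
      have : k ≤ k * d := Nat.le_mul_of_pos_right k hd0
      omega

/-! ### Building cycles and isolating a vertex by a cover -/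

section

variable {W : Type*} {H : SimpleGraph W}

/-- `A` is the vertex set of a path of `H` from `a` to `b`. -/
def HasPathOn (H : SimpleGraph W) (A : Set W) (a b : W) : Prop :=
  ∃ l : List W, l.Nodup ∧ l.IsChain H.Adj ∧ l.head? = some a ∧ l.getLast? = some b ∧ {x | x ∈ l} = A

/-- `A` is the vertex set of a cycle of length `k` in `H`. -/
def HasCycleOn (H : SimpleGraph W) (k : ℕ) (A : Set W) : Prop :=
  ∃ S : H.Subgraph, S.verts = A ∧ Nonempty (S.coe ≃g SimpleGraph.cycleGraph k)

theorem HasPathOn.singleton (a : W) : HasPathOn H {a} a a :=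
  ⟨[a], by simp, by simp, rfl, rfl, by simp⟩

theorem HasPathOn.union {A B : Set W} {a a' b b' : W} (hA : HasPathOn H A a a')
    (hB : HasPathOn H B b b') (hAB : Disjoint A B) (h : H.Adj a' b) :
    HasPathOn H (A ∪ B) a b' := by
  obtain ⟨l, h1, h2, h3, h4, rfl⟩ := hA
  obtain ⟨m, g1, g2, g3, g4, rfl⟩ := hB
  refine ⟨l ++ m, ?_, ?_, ?_, ?_, ?_⟩
  · exact List.nodup_append'.2 ⟨h1, g1, Set.disjoint_left.1 hAB⟩
  · rw [List.isChain_append]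
    refine ⟨h2, g2, ?_⟩
    simpa [h4, g3] using h
  · rw [List.head?_append, h3]
    rfl
  · rw [List.getLast?_append, g4]
    rfl
  · ext x
    simp

theorem HasPathOn.of_isClique {A : Set W} (hA : A.Finite) (hc : H.IsClique A) {a b : W}
    (ha : a ∈ A) (hb : b ∈ A) (hab : a ≠ b) : HasPathOn H A a b := by
  classical
  have hfin : ((A \ {a}) \ {b}).Finite := hA.sdiff.sdiff
  have hmem : ∀ x, x ∈ hfin.toFinset.toList ↔ x ∈ A ∧ x ≠ a ∧ x ≠ b := by
    intro x
    simp [and_assoc]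
  have hl : ∀ x, x ∈ a :: (hfin.toFinset.toList ++ [b]) ↔ x ∈ A := by
    intro x
    simp only [List.mem_cons, List.mem_append, hmem, List.not_mem_nil, or_false]
    constructor
    · rintro (rfl | h | rfl)
      exacts [ha, h.1, hb]
    · intro h
      tauto
  have hn : (a :: (hfin.toFinset.toList ++ [b])).Nodup := by
    rw [List.nodup_cons, List.nodup_append']
    refine ⟨?_, Finset.nodup_toList _, by simp, ?_⟩
    · rw [List.mem_append, hmem]
      simp [hab]
    · intro x hx hx'
      rw [List.mem_singleton] at hx'
      exact ((hmem x).1 hx).2.2 hx'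
  refine ⟨_, hn, List.Pairwise.isChain ?_, rfl, ?_, Set.ext hl⟩
  · exact List.Pairwise.imp_of_mem (fun hx hy hxy => hc ((hl _).1 hx) ((hl _).1 hy) hxy) hn
  · rw [← List.cons_append, List.getLast?_append]
    rfl

theorem HasPathOn.hasCycleOn {A : Set W} {a b : W} (hA : HasPathOn H A a b) (h : H.Adj b a) :
    HasCycleOn H A.ncard A := by
  classical
  obtain ⟨l, h1, h2, h3, h4, rfl⟩ := hA
  have hlen : {x | x ∈ l}.ncard = l.length := by
    rw [← List.toFinset_card_of_nodup h1, ← Set.ncard_coe_finset]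
    congr 1
    ext x
    simp
  rw [hlen]
  -- A cyclic step is either a step along the path or the closing edge from its last vertex to its
  -- first.
  have step : ∀ i j : Fin l.length, (j - i).val = 1 → H.Adj (l.get i) (l.get j) := by
    intro i j hij
    have hi := i.2
    have hj := j.2
    rw [Fin.sub_def] at hij
    simp only at hij
    by_cases hji : i.val < j.val
    · have : j.val = i.val + 1 := by
        rw [show l.length - i.val + j.val = l.length + (j.val - i.val) by omega,
          Nat.add_mod_left, Nat.mod_eq_of_lt (by omega)] at hij
        omega
      have hc := h2.getElem i.val (by omega)
      simpa [this] using hc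
    · have hlt : l.length - i.val + j.val < l.length ∨ i = j := by
        rcases Nat.eq_or_lt_of_not_lt hji with h | h
        · exact Or.inr (Fin.ext h)
        · exact Or.inl (by omega)
      rcases hlt with hlt | rfl
      · rw [Nat.mod_eq_of_lt hlt] at hij
        have hi' : i.val = l.length - 1 := by omega
        have hj' : j.val = 0 := by omega
        rw [List.head?_eq_getElem?] at h3
        rw [List.getLast?_eq_getElem?] at h4
        have e1 : l.get i = b := by
          rw [← hi', List.getElem?_eq_getElem hi] at h4
          exact Option.some.inj h4
        have e2 : l.get j = a := by
          rw [← hj', List.getElem?_eq_getElem hj] at h3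
          exact Option.some.inj h3
        rw [e1, e2]
        exact h
      · rw [Nat.sub_add_cancel hi.le, Nat.mod_self] at hij
        omega
  let f : SimpleGraph.Copy (SimpleGraph.cycleGraph l.length) H :=
    ⟨⟨l.get, fun {i j} hij => by
      rcases SimpleGraph.cycleGraph_adj'.1 hij with h | h
      · exact (step _ _ h).symm
      · exact step _ _ h⟩, List.nodup_iff_injective_get.1 h1⟩
  refine ⟨f.toSubgraph, ?_, ⟨f.isoToSubgraph.symm⟩⟩
  ext x
  simp [f, List.mem_iff_get]

/-- A vertex `e` can be isolated by cycles which cover its neighbours. -/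
theorem structureConnectivity_le_of_cover {k : ℕ} (e : W) (𝒜 : Finset (Set W))
    (hA : ∀ A ∈ 𝒜, HasCycleOn H k A) (he : ∀ A ∈ 𝒜, e ∉ A)
    (hcov : ∀ f, H.Adj e f → ∃ A ∈ 𝒜, f ∈ A) :
    structureConnectivity H (SimpleGraph.cycleGraph k) ≤ 𝒜.card := by
  classical
  choose! S hS hiso using hA
  let F : Set H.Subgraph := S '' 𝒜
  have hF : F.encard ≤ 𝒜.card := by
    refine (Set.encard_image_le _ _).trans ?_
    rw [Set.encard_coe_eq_coe_finsetCard]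
  have hmem : ∀ x, x ∈ familyVerts F ↔ ∃ A ∈ 𝒜, x ∈ A := by
    intro x
    simp only [familyVerts, F, Set.mem_iUnion, Set.mem_image, exists_prop, Finset.mem_coe]
    constructor
    · rintro ⟨_, ⟨A, hA, rfl⟩, hx⟩
      exact ⟨A, hA, hS A hA ▸ hx⟩
    · rintro ⟨A, hA, hx⟩
      exact ⟨_, ⟨A, hA, rfl⟩, (hS A hA).symm ▸ hx⟩
  have heF : e ∈ (familyVerts F)ᶜ := by
    intro h
    obtain ⟨A, hA, h⟩ := (hmem e).1 h
    exact he A hA h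
  refine le_trans (iInf₂_le F ⟨?_, ?_⟩) hF
  -- The isolated vertex may be all that remains; then the cut is of the one-vertex kind.
  · by_cases h : (familyVerts F)ᶜ = {e}
    · exact Or.inr ⟨e, h⟩
    · left
      intro hc
      obtain ⟨f, hf, hfe⟩ : ∃ f ∈ (familyVerts F)ᶜ, f ≠ e := by
        by_contra! hall
        exact h (Set.eq_singleton_iff_unique_mem.2 ⟨heF, hall⟩)
      obtain ⟨p⟩ := hc ⟨e, heF⟩ ⟨f, hf⟩
      cases p with
      | nil => exact hfe rfl
      | @cons _ v _ h p => exact v.2 ((hmem _).2 (hcov _ h))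
  · rintro _ ⟨A, hA, rfl⟩
    exact hiso A hA

/-- Greedy choice. All sets must have exactly $k$ elements, so a last one is padded from `S`. For
$m=0$ nothing is required of $k$; this is used for $k=2n$, where a star is too small to hold a
cycle. -/
theorem exists_cover_by_subsets [Finite W] {S R : Set W} (hR : R ⊆ S) {k : ℕ} (m : ℕ)
    (hk : m ≠ 0 → k ≤ S.ncard) (hm : R.ncard ≤ k * m) : ∃ 𝒜 : Finset (Set W), 𝒜.card ≤ m ∧
      (∀ A ∈ 𝒜, A ⊆ S ∧ A.ncard = k) ∧ ∀ x ∈ R, ∃ A ∈ 𝒜, x ∈ A := by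
  classical
  induction m generalizing R with
  | zero =>
    rw [mul_zero, Nat.le_zero, Set.ncard_eq_zero] at hm
    subst hm
    exact ⟨∅, by simp, by simp, by simp⟩
  | succ m ih =>
    have hk := hk m.succ_ne_zero
    obtain ⟨A, hAS, hAk, hAR⟩ : ∃ A ⊆ S, A.ncard = k ∧ (R \ A).ncard ≤ k * m := by
      by_cases h : R.ncard ≤ k
      · obtain ⟨A, hRA, hAS, hA⟩ := Set.exists_subsuperset_card_eq hR h hk
        refine ⟨A, hAS, hA, ?_⟩
        rw [Set.sdiff_eq_empty.2 hRA, Set.ncard_empty]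
        exact Nat.zero_le _
      · obtain ⟨A, hAR, hA⟩ := Set.exists_subset_card_eq (le_of_not_ge h)
        refine ⟨A, hAR.trans hR, hA, ?_⟩
        rw [Set.ncard_sdiff hAR, hA]
        rw [mul_add, mul_one] at hm
        omega
    obtain ⟨𝒜, h1, h2, h3⟩ := ih (Set.sdiff_subset.trans hR) (fun _ => hk) hAR
    refine ⟨insert A 𝒜, (Finset.card_insert_le _ _).trans (by omega), ?_, ?_⟩
    · intro B hB
      rcases Finset.mem_insert.1 hB with rfl | hB
      · exact ⟨hAS, hAk⟩
      · exact h2 B hB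
    · intro x hx
      by_cases hxA : x ∈ A
      · exact ⟨A, Finset.mem_insert_self _ _, hxA⟩
      · obtain ⟨B, hB, hxB⟩ := h3 x ⟨hx, hxA⟩
        exact ⟨B, Finset.mem_insert_of_mem hB, hxB⟩

end

/-! ### Cycles through one star, two opposite stars, two adjacent stars -/

section

variable {V : Type*} {G : SimpleGraph V}

/-- The edge `uv`, as a vertex of the line graph. -/
def adjEdge {u v : V} (h : G.Adj u v) : G.edgeSet := ⟨s(u, v), h⟩

theorem adjEdge_ne_left {u a b : V} (ha : G.Adj u a) (hb : G.Adj u b) (h : a ≠ b) :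
    adjEdge ha ≠ adjEdge hb := fun e => h (Sym2.congr_right.1 (congrArg Subtype.val e))

theorem adjEdge_ne_right {u a b : V} (ha : G.Adj a u) (hb : G.Adj b u) (h : a ≠ b) :
    adjEdge ha ≠ adjEdge hb := fun e => h (Sym2.congr_left.1 (congrArg Subtype.val e))

theorem edgeStar_isClique (u : V) : G.lineGraph.IsClique (edgeStar G u) :=
  fun _ he _ hf hef => lineGraph_adj_of_mem hef he hf

theorem edgeStar_diff_edgeStar {u v : V} (huv : G.Adj u v) :
    edgeStar G u \ edgeStar G v = edgeStar G u \ {adjEdge huv} := by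
  ext e
  simp only [Set.mem_sdiff, mem_edgeStar, Set.mem_singleton_iff, and_congr_right_iff, not_iff_not]
  intro he
  rw [Subtype.ext_iff, adjEdge, ← Sym2.mem_and_mem_iff huv.ne]
  exact ⟨fun h => ⟨he, h⟩, fun h => h.2⟩

theorem ncard_edgeStar_diff {n : ℕ} (hreg : ∀ x, (G.neighborSet x).ncard = n) {u v : V}
    (huv : G.Adj u v) : (edgeStar G u \ edgeStar G v).ncard = n - 1 := by
  rw [edgeStar_diff_edgeStar huv, Set.ncard_sdiff_singleton_of_mem
    (show adjEdge huv ∈ edgeStar G u from Sym2.mem_mk_left u v),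
    ncard_edgeStar, hreg]

variable [Finite V]

theorem hasCycleOn_edgeStar {u : V} {A : Set G.edgeSet} (hA : A ⊆ edgeStar G u)
    (h : 3 ≤ A.ncard) : HasCycleOn G.lineGraph A.ncard A := by
  obtain ⟨a, ha, b, hb, hab⟩ := (Set.one_lt_ncard (Set.toFinite A)).1 (by omega)
  have hc := (edgeStar_isClique u).subset hA
  exact (HasPathOn.of_isClique (Set.toFinite A) hc ha hb hab).hasCycleOn (hc hb ha hab.symm)

/-- Stars are cliques, so `A` has a spanning path from $ux$ to $ua$ and `B` one from $aw$ to $xw$;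
they join at $a$ and at $x$. A common edge would be $uw$, closing a triangle with $a$. -/
theorem IsClaw.hasCycleOn (hG : ∀ x y z, G.Adj x y → G.Adj y z → G.Adj x z → False)
    {u a x c w : V} (h : IsClaw G u a x c w) {A B : Set G.edgeSet} (hA : A ⊆ edgeStar G u)
    (hB : B ⊆ edgeStar G w) (ha : adjEdge h.adj_a ∈ A) (hx : adjEdge h.adj_x ∈ A)
    (ha' : adjEdge h.adj_aw ∈ B) (hx' : adjEdge h.adj_xw ∈ B) :
    HasCycleOn G.lineGraph (A.ncard + B.ncard) (A ∪ B) := by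
  have hd : Disjoint A B := by
    rw [Set.disjoint_left]
    intro e he he'
    have hu : e.1 = s(u, w) := (Sym2.mem_and_mem_iff h.ne_wu.symm).1 ⟨hA he, hB he'⟩
    have hadj : G.Adj u w := by
      rw [← SimpleGraph.mem_edgeSet, ← hu]
      exact e.2
    exact hG u a w h.adj_a h.adj_aw hadj
  have hne : ∀ e ∈ A, ∀ f ∈ B, e ≠ f := fun e he f hf hef =>
    Set.disjoint_left.1 hd he (hef ▸ hf)
  have p := HasPathOn.of_isClique (Set.toFinite A) ((edgeStar_isClique u).subset hA) hx ha
    (adjEdge_ne_left _ _ h.ne_ax.symm)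
  have q := HasPathOn.of_isClique (Set.toFinite B) ((edgeStar_isClique w).subset hB) ha' hx'
    (adjEdge_ne_right _ _ h.ne_ax)
  rw [← Set.ncard_union_eq hd]
  refine (p.union q hd ?_).hasCycleOn ?_
  · exact lineGraph_adj_of_mem (hne _ ha _ ha') (Sym2.mem_mk_right u a) (Sym2.mem_mk_left a w)
  · exact lineGraph_adj_of_mem (hne _ hx _ hx').symm (Sym2.mem_mk_left x w)
      (Sym2.mem_mk_right u x)

/-- The cycle runs through `A` from $ua$ to $uc$, crosses by $cd$, runs through `B` from $vd$ to
$vb$ and returns by $ab$. The crossing edges are its only two vertices outside the stars of $u$ and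
$v$. -/
theorem IsLadder.hasCycleOn (hG : ∀ x y z, G.Adj x y → G.Adj y z → G.Adj x z → False)
    {u a x c w v b y d z : V} (h : IsLadder G u a x c w v b y d z) {A B : Set G.edgeSet}
    (hA : A ⊆ edgeStar G u \ edgeStar G v) (hB : B ⊆ edgeStar G v \ edgeStar G u)
    (ha : adjEdge h.left.adj_a ∈ A) (hc : adjEdge h.left.adj_c ∈ A)
    (hb : adjEdge h.right.adj_a ∈ B) (hd : adjEdge h.right.adj_c ∈ B) :
    HasCycleOn G.lineGraph (A.ncard + B.ncard + 2)
      ((A ∪ {adjEdge h.adj_cd}) ∪ (B ∪ {adjEdge h.adj_ab})) := by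
  have hu : ∀ {p q : V} (hpq : G.Adj p q), p ≠ u → q ≠ u → adjEdge hpq ∉ edgeStar G u :=
    fun hpq hp hq hm => by
      rcases Sym2.mem_iff.1 hm with rfl | rfl
      exacts [hp rfl, hq rfl]
  have hv : ∀ {p q : V} (hpq : G.Adj p q), p ≠ v → q ≠ v → adjEdge hpq ∉ edgeStar G v :=
    fun hpq hp hq hm => by
      rcases Sym2.mem_iff.1 hm with rfl | rfl
      exacts [hp rfl, hq rfl]
  have hcdA : adjEdge h.adj_cd ∉ A := fun hm =>
    hu h.adj_cd h.left.adj_c.ne' h.ne_du (hA hm).1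
  have habA : adjEdge h.adj_ab ∉ A := fun hm =>
    hu h.adj_ab h.left.adj_a.ne' h.ne_bu (hA hm).1
  have hcdB : adjEdge h.adj_cd ∉ B := fun hm =>
    hv h.adj_cd h.ne_cv h.right.adj_c.ne' (hB hm).1
  have habB : adjEdge h.adj_ab ∉ B := fun hm =>
    hv h.adj_ab h.ne_av h.right.adj_a.ne' (hB hm).1
  have hne : adjEdge h.adj_ab ≠ adjEdge h.adj_cd := by
    intro he
    rcases Sym2.eq_iff.1 (congrArg Subtype.val he) with ⟨hac, -⟩ | ⟨rfl, -⟩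
    · exact h.left.ne_ca hac.symm
    · exact hG u v a h.adj h.right.adj_c h.left.adj_a
  have hAB : Disjoint A B := Set.disjoint_left.2 fun e he he' => (hA he).2 (hB he').1
  have hd1 : Disjoint A {adjEdge h.adj_cd} := Set.disjoint_singleton_right.2 hcdA
  have hd2 : Disjoint B {adjEdge h.adj_ab} := Set.disjoint_singleton_right.2 habB
  have hd3 : Disjoint (A ∪ {adjEdge h.adj_cd}) (B ∪ {adjEdge h.adj_ab}) := by
    rw [Set.disjoint_union_left, Set.disjoint_union_right, Set.disjoint_union_right]
    refine ⟨⟨hAB, Set.disjoint_singleton_right.2 habA⟩, Set.disjoint_singleton_left.2 hcdB,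
      Set.disjoint_singleton.2 hne.symm⟩
  have p := HasPathOn.of_isClique (Set.toFinite A)
    ((edgeStar_isClique u).subset (hA.trans Set.sdiff_subset)) ha hc
    (adjEdge_ne_left _ _ h.left.ne_ca.symm)
  have q := HasPathOn.of_isClique (Set.toFinite B)
    ((edgeStar_isClique v).subset (hB.trans Set.sdiff_subset)) hd hb
    (adjEdge_ne_left _ _ h.right.ne_ca)
  have hcard : A.ncard + B.ncard + 2 =
      ((A ∪ {adjEdge h.adj_cd}) ∪ (B ∪ {adjEdge h.adj_ab})).ncard := by
    rw [Set.ncard_union_eq hd3, Set.ncard_union_eq hd1, Set.ncard_union_eq hd2,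
      Set.ncard_singleton, Set.ncard_singleton]
    omega
  rw [hcard]
  refine HasPathOn.hasCycleOn ((p.union (.singleton _) hd1 ?_).union
    (q.union (.singleton _) hd2 ?_) hd3 ?_) ?_
  · exact lineGraph_adj_of_mem (fun e => hcdA (e ▸ hc)) (Sym2.mem_mk_right u c)
      (Sym2.mem_mk_left c d)
  · exact lineGraph_adj_of_mem (fun e => habB (e ▸ hb)) (Sym2.mem_mk_right v b)
      (Sym2.mem_mk_right a b)
  · exact lineGraph_adj_of_mem (fun e => hcdB (e ▸ hd)) (Sym2.mem_mk_right c d)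
      (Sym2.mem_mk_right v d)
  · exact lineGraph_adj_of_mem (fun e => habA (e ▸ ha)) (Sym2.mem_mk_left a b)
      (Sym2.mem_mk_right u a)

end

/-! ### Upper bounds -/

section

variable {V : Type*} {G : SimpleGraph V} {n : ℕ}

theorem adjEdge_symm {u v : V} (huv : G.Adj u v) : adjEdge huv.symm = adjEdge huv :=
  Subtype.ext Sym2.eq_swap

theorem structureConnectivity_le_of_edgeStar_cover {k : ℕ} {u v : V} (huv : G.Adj u v)
    (𝒜 : Finset (Set G.edgeSet)) (hA : ∀ A ∈ 𝒜, HasCycleOn G.lineGraph k A ∧ adjEdge huv ∉ A)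
    (hu : ∀ f ∈ edgeStar G u \ edgeStar G v, ∃ A ∈ 𝒜, f ∈ A)
    (hv : ∀ f ∈ edgeStar G v \ edgeStar G u, ∃ A ∈ 𝒜, f ∈ A) :
    structureConnectivity G.lineGraph (SimpleGraph.cycleGraph k) ≤ 𝒜.card := by
  refine structureConnectivity_le_of_cover (adjEdge huv) 𝒜 (fun A h => (hA A h).1)
    (fun A h => (hA A h).2) fun f hf => ?_
  obtain ⟨hne, x, hx, hx'⟩ := SimpleGraph.lineGraph_adj_iff_exists.1 hf
  have hfe : ¬ (u ∈ f.1 ∧ v ∈ f.1) := fun h =>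
    hne (Subtype.ext ((Sym2.mem_and_mem_iff huv.ne).1 h).symm)
  rcases Sym2.mem_iff.1 hx with rfl | rfl
  · exact hu f ⟨hx', fun h => hfe ⟨hx', h⟩⟩
  · exact hv f ⟨hx', fun h => hfe ⟨h, hx'⟩⟩

theorem adjEdge_mem_diff_left {u v a : V} (huv : G.Adj u v) (h : G.Adj u a) (ha : a ≠ v) :
    adjEdge h ∈ edgeStar G u \ edgeStar G v := by
  refine ⟨Sym2.mem_mk_left u a, fun hv => ?_⟩
  rcases Sym2.mem_iff.1 hv with rfl | rfl
  exacts [huv.ne rfl, ha rfl]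

variable [Finite V]

theorem exists_edgeStar_cover (hreg : ∀ x, (G.neighborSet x).ncard = n) {k : ℕ} (hk : 3 ≤ k)
    {u v : V} (huv : G.Adj u v) {R : Set G.edgeSet} (hR : R ⊆ edgeStar G u \ edgeStar G v) (m : ℕ)
    (hkn : m ≠ 0 → k ≤ n - 1) (hm : R.ncard ≤ k * m) :
    ∃ 𝒜 : Finset (Set G.edgeSet), 𝒜.card ≤ m ∧
      (∀ A ∈ 𝒜, HasCycleOn G.lineGraph k A ∧ adjEdge huv ∉ A) ∧ ∀ f ∈ R, ∃ A ∈ 𝒜, f ∈ A := by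
  obtain ⟨𝒜, h1, h2, h3⟩ := exists_cover_by_subsets hR m
    (by rwa [ncard_edgeStar_diff hreg huv]) hm
  refine ⟨𝒜, h1, fun A hA => ?_, h3⟩
  obtain ⟨hAs, hAk⟩ := h2 A hA
  refine ⟨?_, fun h => (hAs h).2 (Sym2.mem_mk_right u v)⟩
  have := hasCycleOn_edgeStar (hAs.trans Set.sdiff_subset) (by omega)
  rwa [hAk] at this

theorem structureConnectivity_le_two_mul (hreg : ∀ x, (G.neighborSet x).ncard = n) {k : ℕ}
    (hk : 3 ≤ k) (hkn : k ≤ n - 1) {u v : V} (huv : G.Adj u v) (m : ℕ) (hm : n - 1 ≤ k * m) :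
    structureConnectivity G.lineGraph (SimpleGraph.cycleGraph k) ≤ (2 * m : ℕ) := by
  classical
  obtain ⟨𝒜, h1, h2, h3⟩ := exists_edgeStar_cover hreg hk huv (Set.Subset.refl _) m
    (fun _ => hkn) (by rwa [ncard_edgeStar_diff hreg huv])
  obtain ⟨ℬ, g1, g2, g3⟩ := exists_edgeStar_cover hreg hk huv.symm (Set.Subset.refl _) m
    (fun _ => hkn) (by rwa [ncard_edgeStar_diff hreg huv.symm])
  rw [adjEdge_symm] at g2
  refine (structureConnectivity_le_of_edgeStar_cover huv (𝒜 ∪ ℬ) ?_ ?_ ?_).trans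
    (Nat.cast_le.2 ((Finset.card_union_le _ _).trans (by omega)))
  · intro A hA
    rcases Finset.mem_union.1 hA with hA | hA
    exacts [h2 A hA, g2 A hA]
  · intro f hf
    obtain ⟨A, hA, hfA⟩ := h3 f hf
    exact ⟨A, Finset.mem_union_left _ hA, hfA⟩
  · intro f hf
    obtain ⟨A, hA, hfA⟩ := g3 f hf
    exact ⟨A, Finset.mem_union_right _ hA, hfA⟩

theorem exists_superset_pair_of_ncard {W : Type*} [Finite W] {S : Set W} {a b : W} (ha : a ∈ S)
    (hb : b ∈ S) {p : ℕ} (hp : 2 ≤ p) (hpS : p ≤ S.ncard) :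
    ∃ A ⊆ S, a ∈ A ∧ b ∈ A ∧ A.ncard = p := by
  obtain ⟨A, h1, h2, h3⟩ := Set.exists_subsuperset_card_eq (s := {a, b}) (t := S)
    (by rintro _ (rfl | rfl) <;> assumption)
    (((Set.ncard_insert_le a {b}).trans (by rw [Set.ncard_singleton])).trans hp) hpS
  exact ⟨A, h2, h1 (by simp), h1 (by simp), h3⟩

theorem IsLadder.exists_hasCycleOn (hG : ∀ x y z, G.Adj x y → G.Adj y z → G.Adj x z → False)
    (hreg : ∀ x, (G.neighborSet x).ncard = n)
    {u a x c w v b y d z : V} (h : IsLadder G u a x c w v b y d z) {p q : ℕ} (hp : 2 ≤ p)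
    (hpn : p ≤ n - 1) (hq : 2 ≤ q) (hqn : q ≤ n - 1) :
    ∃ A ⊆ edgeStar G u \ edgeStar G v, ∃ B ⊆ edgeStar G v \ edgeStar G u, ∃ C,
      A.ncard = p ∧ B.ncard = q ∧ adjEdge h.left.adj_c ∈ A ∧ adjEdge h.right.adj_c ∈ B ∧
      A ⊆ C ∧ B ⊆ C ∧ adjEdge h.adj ∉ C ∧ HasCycleOn G.lineGraph (p + q + 2) C := by
  obtain ⟨A, hA, ha, hc, hAp⟩ := exists_superset_pair_of_ncard
    (adjEdge_mem_diff_left h.adj h.left.adj_a h.ne_av)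
    (adjEdge_mem_diff_left h.adj h.left.adj_c h.ne_cv) hp
    (by rwa [ncard_edgeStar_diff hreg h.adj])
  obtain ⟨B, hB, hb, hd, hBq⟩ := exists_superset_pair_of_ncard
    (adjEdge_mem_diff_left h.adj.symm h.right.adj_a h.ne_bu)
    (adjEdge_mem_diff_left h.adj.symm h.right.adj_c h.ne_du) hq
    (by rwa [ncard_edgeStar_diff hreg h.adj.symm])
  have hC := h.hasCycleOn hG hA hB ha hc hb hd
  rw [hAp, hBq] at hC
  refine ⟨A, hA, B, hB, _, hAp, hBq, hc, hd, ?_, ?_, ?_, hC⟩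
  · exact fun f hf => Or.inl (Or.inl hf)
  · exact fun f hf => Or.inr (Or.inl hf)
  · have key : ∀ {s t : V} (hst : G.Adj s t), s ≠ u → t ≠ u → adjEdge h.adj ≠ adjEdge hst := by
      intro s t hst hs ht he
      have : u ∈ s(s, t) := by
        rw [← show s(u, v) = s(s, t) from congrArg Subtype.val he]
        exact Sym2.mem_mk_left u v
      rcases Sym2.mem_iff.1 this with rfl | rfl
      exacts [hs rfl, ht rfl]
    rintro ((hm | hm) | (hm | hm))
    · exact (hA hm).2 (Sym2.mem_mk_right u v)
    · exact key _ h.left.adj_c.ne' h.ne_du hm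
    · exact (hB hm).2 (Sym2.mem_mk_left u v)
    · exact key _ h.left.adj_a.ne' h.ne_bu hm

/-- One ladder cycle serves both ends, with $p$ edges at $u$ and $q$ at $v$; $m$ cycles inside each
star cover the rest. This saves one cycle over treating the ends separately. -/
theorem IsLadder.structureConnectivity_le
    (hG : ∀ x y z, G.Adj x y → G.Adj y z → G.Adj x z → False)
    (hreg : ∀ x, (G.neighborSet x).ncard = n)
    {u a x c w v b y d z : V} (h : IsLadder G u a x c w v b y d z) {k p q m : ℕ} (hp : 2 ≤ p)
    (hpn : p ≤ n - 1) (hq : 2 ≤ q) (hqn : q ≤ n - 1) (hk : p + q + 2 = k)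
    (hkn : m ≠ 0 → k ≤ n - 1) (hpm : n - 1 ≤ k * m + p) (hqm : n - 1 ≤ k * m + q) :
    structureConnectivity G.lineGraph (SimpleGraph.cycleGraph k) ≤ (2 * m + 1 : ℕ) := by
  classical
  obtain ⟨A, hA, B, hB, C, hAp, hBq, -, -, hAC, hBC, heC, hC⟩ :=
    h.exists_hasCycleOn hG hreg hp hpn hq hqn
  rw [hk] at hC
  have hAc := Set.ncard_sdiff hA (Set.toFinite A)
  have hBc := Set.ncard_sdiff hB (Set.toFinite B)
  rw [ncard_edgeStar_diff hreg h.adj, hAp] at hAc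
  rw [ncard_edgeStar_diff hreg h.adj.symm, hBq] at hBc
  obtain ⟨𝒜, h1, h2, h3⟩ := exists_edgeStar_cover hreg (k := k) (by omega) h.adj
    (R := (edgeStar G u \ edgeStar G v) \ A) Set.sdiff_subset m hkn (by omega)
  obtain ⟨ℬ, g1, g2, g3⟩ := exists_edgeStar_cover hreg (k := k) (by omega) h.adj.symm
    (R := (edgeStar G v \ edgeStar G u) \ B) Set.sdiff_subset m hkn (by omega)
  rw [adjEdge_symm] at g2
  refine (structureConnectivity_le_of_edgeStar_cover h.adj (insert C (𝒜 ∪ ℬ)) ?_ ?_ ?_).trans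
    (Nat.cast_le.2 ((Finset.card_insert_le _ _).trans (Nat.succ_le_succ
      ((Finset.card_union_le _ _).trans (by omega)))))
  · intro D hD
    rcases Finset.mem_insert.1 hD with rfl | hD
    · exact ⟨hC, heC⟩
    · rcases Finset.mem_union.1 hD with hD | hD
      exacts [h2 D hD, g2 D hD]
  · intro f hf
    by_cases hfA : f ∈ A
    · exact ⟨C, Finset.mem_insert_self _ _, hAC hfA⟩
    · obtain ⟨D, hD, hfD⟩ := h3 f ⟨hf, hfA⟩
      exact ⟨D, Finset.mem_insert_of_mem (Finset.mem_union_left _ hD), hfD⟩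
  · intro f hf
    by_cases hfB : f ∈ B
    · exact ⟨C, Finset.mem_insert_self _ _, hBC hfB⟩
    · obtain ⟨D, hD, hfD⟩ := g3 f ⟨hf, hfB⟩
      exact ⟨D, Finset.mem_insert_of_mem (Finset.mem_union_right _ hD), hfD⟩

theorem IsLadder.exists_hasCycleOn_superset
    (hG : ∀ x y z, G.Adj x y → G.Adj y z → G.Adj x z → False)
    (hreg : ∀ x, (G.neighborSet x).ncard = n)
    {u a x c w v b y d z : V} (h : IsLadder G u a x c w v b y d z) {A : Set G.edgeSet}
    (hA : A ⊆ edgeStar G u \ edgeStar G v) (ha : adjEdge h.left.adj_a ∈ A)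
    (hx : adjEdge h.left.adj_x ∈ A) {j : ℕ} (hj : 2 ≤ j) (hjn : j ≤ n) :
    ∃ C, A ⊆ C ∧ HasCycleOn G.lineGraph (A.ncard + j) C ∧ adjEdge h.adj ∉ C := by
  obtain ⟨B, hB, hb, hb', hBj⟩ := exists_superset_pair_of_ncard (S := edgeStar G w)
    (show adjEdge h.left.adj_aw ∈ edgeStar G w from Sym2.mem_mk_right a w)
    (show adjEdge h.left.adj_xw ∈ edgeStar G w from Sym2.mem_mk_right x w) hj
    (by rwa [ncard_edgeStar, hreg])
  have hC := h.left.hasCycleOn hG (hA.trans Set.sdiff_subset) hB ha hx hb hb'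
  rw [hBj] at hC
  refine ⟨_, Set.subset_union_left, hC, ?_⟩
  rintro (hm | hm)
  · exact (hA hm).2 (Sym2.mem_mk_right u v)
  · rcases Sym2.mem_iff.1 (hB hm) with hw | hw
    · exact h.left.ne_wu hw
    · have := h.left.adj_aw
      rw [hw] at this
      exact hG u a v h.left.adj_a this h.adj

/-- One claw cycle per end takes the whole star without $uv$ and fills up with $k-(n-1)$ edges at
the opposite corner. That number must lie between $2$ and $n$, which is the range of $k$. -/
theorem IsLadder.structureConnectivity_le_two
    (hG : ∀ x y z, G.Adj x y → G.Adj y z → G.Adj x z → False)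
    (hreg : ∀ x, (G.neighborSet x).ncard = n)
    {u a x c w v b y d z : V} (h : IsLadder G u a x c w v b y d z) {k : ℕ} (hk : n + 1 ≤ k)
    (hkn : k ≤ 2 * n - 1) :
    structureConnectivity G.lineGraph (SimpleGraph.cycleGraph k) ≤ (2 : ℕ) := by
  classical
  obtain ⟨C, hC, h1, h2⟩ := h.exists_hasCycleOn_superset hG hreg (Set.Subset.refl _)
    (adjEdge_mem_diff_left h.adj h.left.adj_a h.ne_av)
    (adjEdge_mem_diff_left h.adj h.left.adj_x h.ne_xv) (j := k - (n - 1)) (by omega) (by omega)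
  obtain ⟨D, hD, g1, g2⟩ := h.symm.exists_hasCycleOn_superset hG hreg (Set.Subset.refl _)
    (adjEdge_mem_diff_left h.adj.symm h.right.adj_a h.ne_bu)
    (adjEdge_mem_diff_left h.adj.symm h.right.adj_x h.ne_yu) (j := k - (n - 1)) (by omega)
    (by omega)
  rw [ncard_edgeStar_diff hreg h.adj, show n - 1 + (k - (n - 1)) = k by omega] at h1
  rw [ncard_edgeStar_diff hreg h.adj.symm, show n - 1 + (k - (n - 1)) = k by omega] at g1
  rw [adjEdge_symm h.adj] at g2
  refine (structureConnectivity_le_of_edgeStar_cover h.adj {C, D} ?_ ?_ ?_).trans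
    (Nat.cast_le.2 Finset.card_le_two)
  · intro A hA
    rcases Finset.mem_insert.1 hA with rfl | hA
    · exact ⟨h1, h2⟩
    · rw [Finset.mem_singleton.1 hA]
      exact ⟨g1, g2⟩
  · exact fun f hf => ⟨C, by simp, hC hf⟩
  · exact fun f hf => ⟨D, by simp, hD hf⟩

/-- A claw cycle needs two edges at the opposite corner, so for $k=n$ it misses one star edge. The
missed edges are chosen as $uc$ and $vd$, and a ladder cycle picks up both. -/
theorem IsLadder.structureConnectivity_le_three
    (hG : ∀ x y z, G.Adj x y → G.Adj y z → G.Adj x z → False)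
    (hreg : ∀ x, (G.neighborSet x).ncard = n)
    {u a x c w v b y d z : V} (h : IsLadder G u a x c w v b y d z) (hn : 6 ≤ n) :
    structureConnectivity G.lineGraph (SimpleGraph.cycleGraph n) ≤ (3 : ℕ) := by
  classical
  have key : ∀ {u a x c w v b y d z : V} (h : IsLadder G u a x c w v b y d z),
      ∃ C, (edgeStar G u \ edgeStar G v) \ {adjEdge h.left.adj_c} ⊆ C ∧
        HasCycleOn G.lineGraph n C ∧ adjEdge h.adj ∉ C := by
    intro u a x c w v b y d z h
    obtain ⟨C, hC, h1, h2⟩ := h.exists_hasCycleOn_superset hG hreg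
      (A := (edgeStar G u \ edgeStar G v) \ {adjEdge h.left.adj_c}) Set.sdiff_subset
      ⟨adjEdge_mem_diff_left h.adj h.left.adj_a h.ne_av,
        adjEdge_ne_left _ _ h.left.ne_ca.symm⟩
      ⟨adjEdge_mem_diff_left h.adj h.left.adj_x h.ne_xv,
        adjEdge_ne_left _ _ h.left.ne_cx.symm⟩ le_rfl (by omega)
    rw [Set.ncard_sdiff_singleton_of_mem (adjEdge_mem_diff_left h.adj h.left.adj_c h.ne_cv),
      ncard_edgeStar_diff hreg h.adj, show n - 1 - 1 + 2 = n by omega] at h1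
    exact ⟨C, hC, h1, h2⟩
  obtain ⟨C, hC, h1, h2⟩ := key h
  obtain ⟨D, hD, g1, g2⟩ := key h.symm
  -- Any $p,q\ge2$ with $p+q+2=n$ would do; $n\ge6$ makes this possible.
  obtain ⟨A, -, B, -, E, -, -, hcA, hdB, hAE, hBE, heE, hE⟩ :=
    h.exists_hasCycleOn hG hreg (p := 2) (q := n - 4) le_rfl (by omega) (by omega) (by omega)
  rw [show 2 + (n - 4) + 2 = n by omega] at hE
  rw [adjEdge_symm h.adj] at g2
  refine (structureConnectivity_le_of_edgeStar_cover h.adj {C, D, E} ?_ ?_ ?_).trans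
    (Nat.cast_le.2 Finset.card_le_three)
  · intro A hA
    simp only [Finset.mem_insert, Finset.mem_singleton] at hA
    rcases hA with rfl | rfl | rfl
    exacts [⟨h1, h2⟩, ⟨g1, g2⟩, ⟨hE, heE⟩]
  · intro f hf
    by_cases hfc : f = adjEdge h.left.adj_c
    · exact ⟨E, by simp, hfc ▸ hAE hcA⟩
    · exact ⟨C, by simp, hC ⟨hf, hfc⟩⟩
  · intro f hf
    by_cases hfd : f = adjEdge h.right.adj_c
    · exact ⟨E, by simp, hfd ▸ hBE hdB⟩
    · exact ⟨D, by simp, hD ⟨hf, hfd⟩⟩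

end

theorem IsLadder.structureConnectivity_le_count {V : Type*} [Finite V] {G : SimpleGraph V}
    {n k r : ℕ} (hn : 5 ≤ n) (hk : 6 ≤ k) (hkn : k ≤ 2 * n) (hr : r = (n - 1) % k)
    (hG : ∀ x y z, G.Adj x y → G.Adj y z → G.Adj x z → False)
    (hreg : ∀ x, (G.neighborSet x).ncard = n)
    {u a x c w v b y d z : V} (h : IsLadder G u a x c w v b y d z) :
    structureConnectivity G.lineGraph (SimpleGraph.cycleGraph k) ≤
      ((if (6 ≤ k ∧ k ≤ n - 1 ∧ 1 ≤ r ∧ r ≤ k / 2 - 1) ∨ k = 2 * n then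
          2 * ⌈((n : ℚ) - 1) / (k : ℚ)⌉₊ - 1
        else if k = n then 3
        else 2 * ⌈((n : ℚ) - 1) / (k : ℚ)⌉₊ : ℕ) : ℕ∞) := by
  have hq := fun m => ceil_div_le_iff (m := m) (show 1 ≤ n by omega) (show 0 < k by omega)
  generalize ⌈((n : ℚ) - 1) / (k : ℚ)⌉₊ = q at hq
  obtain ⟨e, rfl⟩ : ∃ e, q = e + 1 := by
    refine Nat.exists_eq_succ_of_ne_zero ?_
    rintro rfl
    have := (hq 0).1 le_rfl
    omega
  have he := (hq (e + 1)).1 le_rfl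
  split_ifs with hc hkn'
  · rw [show 2 * (e + 1) - 1 = 2 * e + 1 by omega]
    rcases hc with ⟨-, h1, h2, h3⟩ | rfl
    · have hdiv : n - 1 = k * ((n - 1) / k) + r := by
        rw [hr, Nat.div_add_mod]
      have hle : (n - 1) / k ≤ e := by
        rw [Nat.div_le_iff_le_mul_add_pred (by omega)]
        rw [mul_add, mul_one] at he
        have hlt : k * ((n - 1) / k) < k * (e + 1) := by
          rw [mul_add, mul_one]
          omega
        have := Nat.le_of_lt_succ (Nat.lt_of_mul_lt_mul_left hlt)
        have := Nat.mul_le_mul_left k this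
        omega
      have := Nat.mul_le_mul_left k hle
      -- The most even split of $k-2$: both parts are at least $\lfloor k/2\rfloor-1\ge r$, the
      -- number of edges left over at each end.
      exact h.structureConnectivity_le hG hreg (p := (k - 2) / 2) (q := k - 2 - (k - 2) / 2)
        (by omega) (by omega) (by omega) (by omega) (by omega) (fun _ => h1) (by omega) (by omega)
    · have h0 : e + 1 ≤ 1 := (hq 1).2 (by omega)
      obtain rfl : e = 0 := by omega
      exact h.structureConnectivity_le hG hreg (p := n - 1) (q := n - 1)
        (by omega) (by omega) (by omega) (by omega) (by omega) (fun h => absurd rfl h) (by omega)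
        (by omega)
  · subst hkn'
    exact h.structureConnectivity_le_three hG hreg hk
  · by_cases hk' : k ≤ n - 1
    · exact structureConnectivity_le_two_mul hreg (by omega) hk' h.adj _ he
    · exact (h.structureConnectivity_le_two hG hreg (by omega) (by omega)).trans
        (Nat.cast_le.2 (by omega))

/-! ### The structure connectivity of the BCDC network -/

theorem theorem4p15 (n k r : ℕ) (hn : 5 ≤ n) (hk : 6 ≤ k) (hkn : k ≤ 2 * n)
    (hr : r = (n - 1) % k) :
    structureConnectivity (bcdc n) (SimpleGraph.cycleGraph k) =
      ((if (6 ≤ k ∧ k ≤ n - 1 ∧ 1 ≤ r ∧ r ≤ k / 2 - 1) ∨ k = 2 * n then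
          2 * ⌈((n : ℚ) - 1) / (k : ℚ)⌉₊ - 1
        else if k = n then 3
        else 2 * ⌈((n : ℚ) - 1) / (k : ℚ)⌉₊ : ℕ) : ℕ∞) := by
  rw [structureConnectivity_bcdc (by omega)]
  refine le_antisymm ?_ (le_iInf₂ fun F hF => ?_)
  · obtain ⟨u, a, x, c, w, v, b, y, d, z, h⟩ := exists_isLadder_crossedCube hn
    exact h.structureConnectivity_le_count hn hk hkn hr (crossedCube_triangleFree n)
      (ncard_neighborSet_crossedCube n)
  · rcases F.finite_or_infinite with hfin | hinf
    swap
    · rw [hinf.encard_eq]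
      exact le_top
    obtain ⟨T, rfl⟩ := hfin.exists_finset_coe
    rw [Set.encard_coe_eq_coe_finsetCard]
    -- Here $n\ge5$ is what gives $3n-4\ge2n+1$.
    have hB : ∀ X : Set (BitVec n), 3 ≤ X.ncard → X.ncard + 3 ≤ Nat.card (BitVec n) →
        2 * n + 1 ≤ (boundaryPairs (crossedCube n) X).ncard := by
      intro X h1 h2
      rw [card_bitVec] at h2
      have := le_ncard_boundaryPairs_of_three_le (by omega) X h1 h2
      omega
    obtain ⟨h1, h2⟩ := IsStructureCut.card_bounds (by omega) (by omega)
      (ncard_neighborSet_crossedCube n) (crossedCube_triangleFree n) hB hF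
    exact Nat.cast_le.2 (structure_count_le hn hk hkn hr h1 h2)
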